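/- **Conventions.** Let $\Delta$ be the simplicial category, with objects $p\ge 0$ and morphisms $p\to m$ the order-preserving maps $\{0,\dots,p\}\to\{0,\dots,m\}$. For $m\ge 1$ a *principal edge* of $m$ is a morphism $1\to m$ sending $0\mapsto i-1$, $1\mapsto i$ with $1\le i\le m$. A *Segal precat* is a bisimplicial set $A=\{A_{p,k}\}$ such that the simplicial set $k\mapsto A_{0,k}$ is constant (with value denoted $A_0$). Write $A_{p/}$ for the simplicial set $k\mapsto A_{p,k}$, and $|A|$ for the geometric realization of $A$, that is, of the diagonal $k\mapsto A_{k,k}$. The *Segal map* $A_{m/}\to A_{1/}\times_{A_0}\cdots\times_{A_0}A_{1/}$ ($m$ factors) is the map whose components are given by the principal edges of $m$. A *weak equivalence of spaces* is a continuous map inducing a bijection on path components and bijections on all homotopy groups $\pi_n$, $n\ge 1$, at all base points. **Construction.** Let $A$ be a Segal precat and $m\ge 1$. Let $I$ be the standard simplicial interval and $$C=(I\times A_{m/})\cup^{\{1\}\times A_{m/}}\bigl(A_{1/}\times_{A_0}\cdots\times_{A_0}A_{1/}\bigr)$$ the mapping cylinder of the Segal map, $a:A_{m/}\hookrightarrow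 C$ the inclusion of $\{0\}\times A_{m/}$, and $b:C\to A_{1/}\times_{A_0}\cdots\times_{A_0}A_{1/}$ the map induced by the projection $I\times A_{m/}\to A_{m/}$ and the identity. Let $Arr(A,m)_{p/}$ be the pushout of $A_{p/}$ with one copy of $a:A_{m/}\to C$ for each map $p\to m$ that does not factor through a principal edge, glued along the induced maps $A_{m/}\to A_{p/}$. For $q\to p$, the map $Arr(A,m)_{p/}\to Arr(A,m)_{q/}$ is the given one on $A_{p/}$; it sends the copy of $C$ indexed by $p\to m$ to the copy indexed by the composite $q\to p\to m$ if that composite does not factor through a principal edge, and if it factors as $q\to 1\to m$ with $1\to m$ a principal edge, it is the composite of the corresponding component $C\to A_{1/}$ of $b$ with $A_{1/}\to A_{q/}\to Arr(A,m)_{q/}$. This is independent of the factorization and defines a bisimplicial set $Arr(A,m)$ with a morphism $A\to Arr(A,m)$. For simplicial sets $X,B$ let $(X\otimes B)_{p,q}=X_p\times B_q$. Let $h(m)$ be the standard $m$-simplex and $\Sigma(m)\subset h(m)$ the union of its principal edges. Put $$U=(\Sigma(m)\otimes C)\cup^{\Sigma(m)\otimes A_{m/}}(h(m)\otimes A_{m/}),\qquad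 V=h(m)\otimes C,$$ formed with $a:A_{m/}\to C$, with the canonical map $U\to V$. Let $U\to A$ be the morphism given on $\Sigma(m)\otimes C$ by $b$ and on $h(m)\otimes A_{m/}$ by the identity of $A_{m/}$, where morphisms $h(m)\otimes B\to A$ correspond to maps $B\to A_{m/}$, and morphisms $\Sigma(m)\otimes B\to A$ to maps $B\to A_{1/}\times_{A_0}\cdots\times_{A_0}A_{1/}$. Let $V\to Arr(A,m)$ be the morphism corresponding to the map $C\to Arr(A,m)_{m/}$ attached to the identity of $m$ (the inclusion of the copy of $C$ indexed by $\mathrm{id}_m$ if $m\ge 2$; the map $b$ followed by $A_{1/}\to Arr(A,1)_{1/}$ if $m=1$). **Lemma.** For every Segal precat $A$ and every integer $m\ge 1$: 1. $Arr(A,m)$ is a Segal precat and $A\to Arr(A,m)$ is a monomorphism of bisimplicial sets; 2. the morphisms above form a pushout square of bisimplicial sets, $Arr(A,m)=A\cup^U V$; 3. $|U|\to|V|$ is a weak equivalence of spaces; 4. the induced map $|A|\hookrightarrow|Arr(A,m)|$ is a topological embedding and a weak equivalence of spaces. -/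

import Mathlib

open CategoryTheory CategoryTheory.Limits Opposite MonoidalCategory Simplicial

universe u

noncomputable section

namespace SegalPrecat

/-! ### Weak equivalences of topological spaces -/

section WeakEquivalence

variable {X Y : Type u} [TopologicalSpace X] [TopologicalSpace Y]

/-- The map induced by a continuous map on path components. -/
def pi0Map (f : C(X, Y)) : ZerothHomotopy X → ZerothHomotopy Y :=
  ZerothHomotopy.lift (fun x => ZerothHomotopy.mk (f x))
    (fun _ _ p => ZerothHomotopy.sound (p.map f.continuous))

/-- The image of an `n`-dimensional loop under a continuous map. -/
def genLoopMap (f : C(X, Y)) (n : ℕ) (x : X) (γ : GenLoop (Fin n) X x) :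
    GenLoop (Fin n) Y (f x) :=
  ⟨f.comp γ.1, fun y hy => congrArg f (γ.2 y hy)⟩

/-- The map induced by a continuous map on the `n`-th homotopy group. -/
def piMap (f : C(X, Y)) (n : ℕ) (x : X) :
    HomotopyGroup.Pi n X x → HomotopyGroup.Pi n Y (f x) :=
  Quotient.map (genLoopMap f n x) (fun _ _ h => h.map fun H => H.compContinuousMap f)

/-- A weak equivalence of spaces: bijective on path components, and on all homotopy groups
in degrees `n ≥ 1` at all base points. -/
structure IsWeakEquivalence (f : C(X, Y)) : Prop where
  bijective_pi0 : Function.Bijective (pi0Map f)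
  bijective_pi : ∀ (n : ℕ), 1 ≤ n → ∀ x : X, Function.Bijective (piMap f n x)

end WeakEquivalence

/-! ### Bisimplicial sets and their realization -/

/-- Bisimplicial sets. For `A : BiSSet` the simplicial set `A_{p/}` (that is `k ↦ A_{p,k}`) is
`A.obj (op ⦋p⦌)`. -/
abbrev BiSSet : Type (u + 1) := SimplicialObject SSet.{u}

/-- The diagonal simplicial set `k ↦ A_{k,k}` of a bisimplicial set. -/
def diagonal : BiSSet.{u} ⥤ SSet.{u} where
  obj A :=
    { obj := fun k => (A.obj k).obj k
      map := fun {k l} φ => (A.obj k).map φ ≫ (A.map φ).app l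
      map_id := by intro k; simp
      map_comp := by intro k l n φ ψ; simp }
  map F :=
    { app := fun k => (F.app k).app k
      naturality := by
        intro k l φ
        have h := congrArg (fun t => t.app l) (F.naturality φ)
        simp only [NatTrans.comp_app] at h
        rw [Category.assoc, h, ← Category.assoc, ← Category.assoc, (F.app k).naturality] }

/-- The geometric realization of a bisimplicial set: the geometric realization of its diagonal. -/
def realization : BiSSet.{u} ⥤ TopCat.{u} := diagonal ⋙ SSet.toTop

/-- A Segal precat is a bisimplicial set `A` satisfying the globular condition: the simplicial set
`k ↦ A_{0,k}` is constant. -/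
def IsSegalPrecat (A : BiSSet.{u}) : Prop :=
  ∀ ⦃k l : SimplexCategoryᵒᵖ⦄ (φ : k ⟶ l), IsIso ((A.obj (op ⦋0⦌)).map φ)

/-! ### The Segal map and its mapping cylinder -/

/-- The iterated fibre product `A_{1/} ×_{A_0} ⋯ ×_{A_0} A_{1/}` with `m` factors: families of
`m` simplices of `A_{1/}` such that the target of each one is the source of the next one. -/
def segalProduct (A : BiSSet.{u}) (m : ℕ) : SSet.{u} where
  obj k := {x : Fin m → (A.obj (op ⦋1⦌)).obj k //
    ∀ i j : Fin m, (j : ℕ) = i + 1 → (A.δ 0).app k (x i) = (A.δ 1).app k (x j)}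
  map {k l} φ := TypeCat.ofHom fun x => ⟨fun i => (A.obj (op ⦋1⦌)).map φ (x.1 i), by
    intro i j hij
    rw [NatTrans.naturality_apply, NatTrans.naturality_apply, x.2 i j hij]⟩
  map_id k := by ext x i; simp
  map_comp φ ψ := by ext x i; simp

/-- The projection of the iterated fibre product to its `i`-th factor. -/
def segalProductProj (A : BiSSet.{u}) {m : ℕ} (i : Fin m) :
    segalProduct A m ⟶ A.obj (op ⦋1⦌) where
  app _ := TypeCat.ofHom fun x => x.1 i
  naturality _ _ _ := rfl

lemma mkOfSucc_comp {m : ℕ} (i j : Fin m) (hij : (j : ℕ) = i + 1) :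
    SimplexCategory.δ 0 ≫ SimplexCategory.mkOfSucc i =
      SimplexCategory.δ 1 ≫ SimplexCategory.mkOfSucc j := by
  ext x
  fin_cases x
  change ((i.succ : Fin (m + 1)) : ℕ) = (j.castSucc : Fin (m + 1))
  simp [hij]

/-- The Segal map `A_{m/} ⟶ A_{1/} ×_{A_0} ⋯ ×_{A_0} A_{1/}`, whose components are given by the
principal edges of `m` (the `i`-th principal edge is `SimplexCategory.mkOfSucc i`). -/
def segalMap (A : BiSSet.{u}) (m : ℕ) : A.obj (op ⦋m⦌) ⟶ segalProduct A m where
  app k := TypeCat.ofHom fun x =>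
    ⟨fun i => (A.map (SimplexCategory.mkOfSucc i).op).app k x, by
      intro i j hij
      have h := congrArg (fun e => (A.map (Quiver.Hom.op e)).app k x) (mkOfSucc_comp i j hij)
      rw [op_comp, op_comp, A.map_comp, A.map_comp] at h
      exact h⟩
  naturality k l φ := by
    ext x
    exact Subtype.ext (funext fun i =>
      NatTrans.naturality_apply (A.map (SimplexCategory.mkOfSucc i).op) φ x)

/-- The mapping cylinder `C` of the Segal map: the cylinder `A_{m/} × I`, glued along its second
end `A_{m/} × {1}` to the iterated fibre product. -/
def cyl (A : BiSSet.{u}) (m : ℕ) : SSet.{u} :=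
  pushout (SSet.ι₁ (X := A.obj (op ⦋m⦌))) (segalMap A m)

/-- The canonical map `A_{m/} × I ⟶ C`. -/
def cylInl (A : BiSSet.{u}) (m : ℕ) : A.obj (op ⦋m⦌) ⊗ Δ[1] ⟶ cyl A m :=
  pushout.inl _ _

/-- The inclusion `a : A_{m/} ⟶ C` of the first end `A_{m/} × {0}` of the cylinder. -/
def cylIncl (A : BiSSet.{u}) (m : ℕ) : A.obj (op ⦋m⦌) ⟶ cyl A m :=
  SSet.ι₀ ≫ cylInl A m

/-- The projection `b : C ⟶ A_{1/} ×_{A_0} ⋯ ×_{A_0} A_{1/}`, induced by the projection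
`A_{m/} × I ⟶ A_{m/}`. -/
def cylProj (A : BiSSet.{u}) (m : ℕ) : cyl A m ⟶ segalProduct A m :=
  pushout.desc (CartesianMonoidalCategory.fst _ _ ≫ segalMap A m) (𝟙 _)
    (by rw [← Category.assoc, SSet.ι₁_fst, Category.id_comp, Category.comp_id])

lemma cylIncl_cylProj (A : BiSSet.{u}) (m : ℕ) : cylIncl A m ≫ cylProj A m = segalMap A m := by
  have h : cylInl A m ≫ cylProj A m = CartesianMonoidalCategory.fst _ _ ≫ segalMap A m :=
    pushout.inl_desc _ _ _
  rw [cylIncl, Category.assoc, h, ← Category.assoc, SSet.ι₀_fst, Category.id_comp]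

/-! ### The operation `Arr` -/

/-- The map `g : q ⟶ m` of the simplicial category factors through a principal edge of `m`. -/
def FactorsThroughEdge {q : SimplexCategory} {m : ℕ} (g : q ⟶ ⦋m⦌) : Prop :=
  ∃ (i : Fin m) (e : q ⟶ ⦋1⦌), e ≫ SimplexCategory.mkOfSucc i = g

lemma FactorsThroughEdge.precomp {p q : SimplexCategory} {m : ℕ} {g : q ⟶ ⦋m⦌}
    (hg : FactorsThroughEdge g) (φ : p ⟶ q) : FactorsThroughEdge (φ ≫ g) := by
  obtain ⟨i, e, rfl⟩ := hg
  exact ⟨i, φ ≫ e, by simp⟩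

/-- For `g : q ⟶ m` factoring through the `i`-th principal edge by `e : q ⟶ 1`, the map
`A_{1/} ×_{A_0} ⋯ ×_{A_0} A_{1/} ⟶ A_{1/} ⟶ A_{q/}` obtained from the `i`-th projection and `e`.
It does not depend on the factorization, see `edgeMap_eq`. -/
def edgeMap (A : BiSSet.{u}) {q : SimplexCategory} {m : ℕ} (g : q ⟶ ⦋m⦌)
    (hg : FactorsThroughEdge g) : segalProduct A m ⟶ A.obj (op q) :=
  segalProductProj A hg.choose ≫ A.map hg.choose_spec.choose.op

lemma edgeMap_aux (A : BiSSet.{u}) {q : SimplexCategory} {m : ℕ} (i j : Fin m) (hij : i < j)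
    (d e : q ⟶ ⦋1⦌)
    (h : d ≫ SimplexCategory.mkOfSucc i = e ≫ SimplexCategory.mkOfSucc j) :
    segalProductProj A i ≫ A.map d.op = segalProductProj A j ≫ A.map e.op := by
  have key : ∀ x, (d.toOrderHom x : Fin 2) = 1 ∧ (e.toOrderHom x : Fin 2) = 0 ∧
      (j : ℕ) = i + 1 := by
    intro x
    have hx := congrArg (fun t => ((SimplexCategory.Hom.toOrderHom t x : Fin (m + 1)) : ℕ)) h
    have hi : ∀ (k : Fin m) (y : Fin 2),
        (((SimplexCategory.Hom.toOrderHom (SimplexCategory.mkOfSucc k) : Fin 2 → Fin (m + 1)) y :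
          Fin (m + 1)) : ℕ) = k + y := by
      intro k y
      fin_cases y <;> rfl
    change (((SimplexCategory.Hom.toOrderHom (SimplexCategory.mkOfSucc i) : Fin 2 → Fin (m + 1))
      (d.toOrderHom x) : Fin (m + 1)) : ℕ) =
      (((SimplexCategory.Hom.toOrderHom (SimplexCategory.mkOfSucc j) : Fin 2 → Fin (m + 1))
      (e.toOrderHom x) : Fin (m + 1)) : ℕ) at hx
    rw [hi, hi] at hx
    generalize (d.toOrderHom x : Fin 2) = y at hx ⊢
    generalize (e.toOrderHom x : Fin 2) = z at hx ⊢
    have := y.isLt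
    have := z.isLt
    exact ⟨Fin.ext (show (y : ℕ) = 1 by omega), Fin.ext (show (z : ℕ) = 0 by omega), by omega⟩
  let c : q ⟶ ⦋0⦌ := SimplexCategory.Hom.mk ⟨fun _ => 0, fun _ _ _ => le_rfl⟩
  have hd : d = c ≫ SimplexCategory.δ 0 := by
    ext x
    exact congrArg Fin.val (key x).1
  have he : e = c ≫ SimplexCategory.δ 1 := by
    ext x
    exact congrArg Fin.val (key x).2.1
  have hj := (key 0).2.2
  have hδ : segalProductProj A i ≫ A.δ 0 = segalProductProj A j ≫ A.δ 1 := by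
    ext k x
    exact x.2 i j hj
  rw [hd, he, op_comp, op_comp, A.map_comp, A.map_comp]
  change segalProductProj A i ≫ A.δ 0 ≫ _ = segalProductProj A j ≫ A.δ 1 ≫ _
  rw [← Category.assoc, hδ, Category.assoc]

lemma edgeMap_eq (A : BiSSet.{u}) {q : SimplexCategory} {m : ℕ} (g : q ⟶ ⦋m⦌)
    (hg : FactorsThroughEdge g) (i : Fin m) (e : q ⟶ ⦋1⦌)
    (h : e ≫ SimplexCategory.mkOfSucc i = g) :
    edgeMap A g hg = segalProductProj A i ≫ A.map e.op := by
  have hc := hg.choose_spec.choose_spec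
  rw [edgeMap]
  generalize hg.choose_spec.choose = d at hc ⊢
  generalize hg.choose = j at d hc ⊢
  rw [← h] at hc
  rcases lt_trichotomy j i with hji | rfl | hij
  · exact edgeMap_aux A j i hji d e hc
  · have : d = e := by
      ext x
      have hx := congrArg (fun t => ((SimplexCategory.Hom.toOrderHom t x : Fin (m + 1)) : ℕ)) hc
      have hi : ∀ (y : Fin 2),
          (((SimplexCategory.Hom.toOrderHom (SimplexCategory.mkOfSucc j) :
            Fin 2 → Fin (m + 1)) y : Fin (m + 1)) : ℕ) = j + y := by
        intro y
        fin_cases y <;> rfl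
      change (((SimplexCategory.Hom.toOrderHom (SimplexCategory.mkOfSucc j) :
        Fin 2 → Fin (m + 1)) (d.toOrderHom x) : Fin (m + 1)) : ℕ) =
        (((SimplexCategory.Hom.toOrderHom (SimplexCategory.mkOfSucc j) : Fin 2 → Fin (m + 1))
        (e.toOrderHom x) : Fin (m + 1)) : ℕ) at hx
      rw [hi, hi] at hx
      exact Nat.add_left_cancel hx
    rw [this]
  · exact (edgeMap_aux A i j hij e d hc.symm).symm

lemma segalMap_edgeMap (A : BiSSet.{u}) {q : SimplexCategory} {m : ℕ} (g : q ⟶ ⦋m⦌)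
    (hg : FactorsThroughEdge g) : segalMap A m ≫ edgeMap A g hg = A.map g.op := by
  obtain ⟨i, e, h⟩ := id hg
  rw [edgeMap_eq A g _ i e h, ← h, op_comp, A.map_comp, ← Category.assoc]
  rfl

lemma edgeMap_map (A : BiSSet.{u}) {p q : SimplexCategory} {m : ℕ} (g : q ⟶ ⦋m⦌)
    (hg : FactorsThroughEdge g) (φ : p ⟶ q) :
    edgeMap A g hg ≫ A.map φ.op = edgeMap A (φ ≫ g) (hg.precomp φ) := by
  obtain ⟨i, e, h⟩ := id hg
  rw [edgeMap_eq A g _ i e h, edgeMap_eq A (φ ≫ g) _ i (φ ≫ e) (by rw [Category.assoc, h]),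
    op_comp, A.map_comp, Category.assoc]

/-- The maps `p ⟶ m` not factoring through a principal edge. -/
abbrev NonEdge (p : SimplexCategory) (m : ℕ) : Type :=
  {g : p ⟶ ⦋m⦌ // ¬ FactorsThroughEdge g}

instance (p : SimplexCategory) (m : ℕ) : Finite (NonEdge p m) := by
  have : Function.Injective (fun (g : NonEdge p m) (x : Fin (p.len + 1)) =>
      (g.1.toOrderHom x : Fin (m + 1))) := by
    intro g h hgh
    apply Subtype.ext
    ext x
    exact congrArg Fin.val (congrFun hgh x)
  exact Finite.of_injective _ this

/-- The simplicial set `Arr(A,m)_{p/}`: the pushout of `A_{p/}` with copies of `a : A_{m/} ⟶ C`,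
one copy for each map `p ⟶ m` not factoring through a principal edge, along the induced maps
`A_{m/} ⟶ A_{p/}`. -/
def arrObj (A : BiSSet.{u}) (m : ℕ) (p : SimplexCategory) : SSet.{u} :=
  pushout
    (Limits.Sigma.desc (fun g : NonEdge p m => A.map g.1.op) :
      (∐ fun _ : NonEdge p m => A.obj (op ⦋m⦌)) ⟶ A.obj (op p))
    (Limits.Sigma.map (fun _ : NonEdge p m => cylIncl A m))

/-- The inclusion `A_{p/} ⟶ Arr(A,m)_{p/}`. -/
def arrInclApp (A : BiSSet.{u}) (m : ℕ) (p : SimplexCategory) : A.obj (op p) ⟶ arrObj A m p :=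
  pushout.inl _ _

/-- The copy of `C` in `Arr(A,m)_{p/}` indexed by a map `p ⟶ m` not factoring through a principal
edge. -/
def arrCopy (A : BiSSet.{u}) (m : ℕ) {p : SimplexCategory} (g : NonEdge p m) :
    cyl A m ⟶ arrObj A m p :=
  Limits.Sigma.ι (fun _ : NonEdge p m => cyl A m) g ≫ pushout.inr _ _

open Classical in
/-- For `g : p ⟶ m`, the map `C ⟶ Arr(A,m)_{p/}` attached to `g`. If `g` does not factor through
a principal edge, it is the inclusion of the copy of `C` with index `g`; otherwise it is the
component `C ⟶ A_{1/}` of `b` given by the principal edge, followed by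
`A_{1/} ⟶ A_{p/} ⟶ Arr(A,m)_{p/}`. -/
def arrCyl (A : BiSSet.{u}) (m : ℕ) {p : SimplexCategory} (g : p ⟶ ⦋m⦌) :
    cyl A m ⟶ arrObj A m p :=
  if hg : FactorsThroughEdge g then cylProj A m ≫ edgeMap A g hg ≫ arrInclApp A m p
  else arrCopy A m ⟨g, hg⟩

lemma arrCyl_of_factors (A : BiSSet.{u}) (m : ℕ) {p : SimplexCategory} (g : p ⟶ ⦋m⦌)
    (hg : FactorsThroughEdge g) :
    arrCyl A m g = cylProj A m ≫ edgeMap A g hg ≫ arrInclApp A m p :=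
  dif_pos hg

lemma arrCyl_of_not_factors (A : BiSSet.{u}) (m : ℕ) {p : SimplexCategory} (g : p ⟶ ⦋m⦌)
    (hg : ¬ FactorsThroughEdge g) :
    arrCyl A m g = arrCopy A m ⟨g, hg⟩ :=
  dif_neg hg

lemma cylIncl_arrCyl (A : BiSSet.{u}) (m : ℕ) {p : SimplexCategory} (g : p ⟶ ⦋m⦌) :
    cylIncl A m ≫ arrCyl A m g = A.map g.op ≫ arrInclApp A m p := by
  by_cases hg : FactorsThroughEdge g
  · rw [arrCyl_of_factors A m g hg, ← Category.assoc, cylIncl_cylProj, ← Category.assoc,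
      segalMap_edgeMap]
  · have h := congrArg (fun t => Limits.Sigma.ι (fun _ : NonEdge p m => A.obj (op ⦋m⦌)) ⟨g, hg⟩ ≫ t)
      (pushout.condition
        (f := (Limits.Sigma.desc (fun g : NonEdge p m => A.map g.1.op) :
          (∐ fun _ : NonEdge p m => A.obj (op ⦋m⦌)) ⟶ A.obj (op p)))
        (g := Limits.Sigma.map (fun _ : NonEdge p m => cylIncl A m)))
    simp only [Limits.Sigma.ι_desc_assoc, Limits.Sigma.ι_map_assoc] at h
    rw [arrCyl_of_not_factors A m g hg]
    exact h.symm

lemma arr_hom_ext {A : BiSSet.{u}} {m : ℕ} {p : SimplexCategory} {Z : SSet.{u}}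
    {f g : arrObj A m p ⟶ Z} (h₁ : arrInclApp A m p ≫ f = arrInclApp A m p ≫ g)
    (h₂ : ∀ e : p ⟶ ⦋m⦌, ¬ FactorsThroughEdge e → arrCyl A m e ≫ f = arrCyl A m e ≫ g) :
    f = g := by
  apply pushout.hom_ext h₁
  apply Limits.Sigma.hom_ext
  intro e
  have h := h₂ e.1 e.2
  rw [arrCyl_of_not_factors A m e.1 e.2] at h
  exact (Category.assoc _ _ _).symm.trans (h.trans (Category.assoc _ _ _))

/-- The functoriality `Arr(A,m)_{p/} ⟶ Arr(A,m)_{q/}` for `φ : q ⟶ p`: it is the functoriality of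
`A` on `A_{p/}`, and it sends the copy of `C` with index `g : p ⟶ m` to `Arr(A,m)_{q/}` by the map
attached to the composition `q ⟶ p ⟶ m`. -/
def arrMap (A : BiSSet.{u}) (m : ℕ) {p q : SimplexCategory} (φ : q ⟶ p) :
    arrObj A m p ⟶ arrObj A m q :=
  pushout.desc (A.map φ.op ≫ arrInclApp A m q)
    (Limits.Sigma.desc fun g : NonEdge p m => arrCyl A m (φ ≫ g.1)) (by
      apply Limits.Sigma.hom_ext
      intro g
      simp only [Limits.Sigma.ι_desc_assoc, Limits.Sigma.ι_map_assoc, Limits.Sigma.ι_desc]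
      rw [cylIncl_arrCyl, op_comp, A.map_comp, Category.assoc])

lemma arrInclApp_arrMap (A : BiSSet.{u}) (m : ℕ) {p q : SimplexCategory} (φ : q ⟶ p) :
    arrInclApp A m p ≫ arrMap A m φ = A.map φ.op ≫ arrInclApp A m q :=
  pushout.inl_desc _ _ _

lemma arrCyl_arrMap (A : BiSSet.{u}) (m : ℕ) {p q : SimplexCategory} (φ : q ⟶ p)
    (g : p ⟶ ⦋m⦌) : arrCyl A m g ≫ arrMap A m φ = arrCyl A m (φ ≫ g) := by
  by_cases hg : FactorsThroughEdge g
  · rw [arrCyl_of_factors A m g hg, arrCyl_of_factors A m _ (hg.precomp φ), Category.assoc,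
      Category.assoc, arrInclApp_arrMap, ← edgeMap_map, Category.assoc]
  · rw [arrCyl_of_not_factors A m g hg]
    refine (Category.assoc _ _ _).trans ?_
    refine (congrArg (fun t => _ ≫ t) (pushout.inr_desc _ _ _)).trans ?_
    exact Limits.Sigma.ι_desc _ _

/-- The bisimplicial set `Arr(A,m)`. -/
def arr (A : BiSSet.{u}) (m : ℕ) : BiSSet.{u} where
  obj p := arrObj A m p.unop
  map φ := arrMap A m φ.unop
  map_id p := by
    apply arr_hom_ext
    · rw [arrInclApp_arrMap, Category.comp_id]
      simp
    · intro e _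
      rw [arrCyl_arrMap, Category.comp_id]
      simp
  map_comp φ ψ := by
    apply arr_hom_ext
    · rw [arrInclApp_arrMap, ← Category.assoc, arrInclApp_arrMap, Category.assoc,
        arrInclApp_arrMap, ← Category.assoc, ← A.map_comp]
      rfl
    · intro e _
      rw [arrCyl_arrMap, ← Category.assoc, arrCyl_arrMap, arrCyl_arrMap]
      simp

/-- The inclusion `A ⟶ Arr(A,m)`. -/
def arrIncl (A : BiSSet.{u}) (m : ℕ) : A ⟶ arr A m where
  app p := arrInclApp A m p.unop
  naturality _ _ φ := (arrInclApp_arrMap A m φ.unop).symm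

/-! ### The attaching map `U ⟶ V` -/

/-- The exterior product `(X ⊗ B)_{p,k} = X_p × B_k` of two simplicial sets. -/
def extProd (X B : SSet.{u}) : BiSSet.{u} where
  obj p :=
    { obj := fun k => X.obj p × B.obj k
      map := fun φ => TypeCat.ofHom fun x => (x.1, B.map φ x.2)
      map_id := by intro k; ext x <;> simp
      map_comp := by intro k l n φ ψ; ext x <;> simp }
  map θ :=
    { app := fun k => TypeCat.ofHom fun x => (X.map θ x.1, x.2)
      naturality := fun _ _ _ => rfl }
  map_id p := by ext k x <;> simp
  map_comp θ η := by ext k x <;> simp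

/-- Functoriality of the exterior product. -/
def extProdMap {X X' B B' : SSet.{u}} (f : X ⟶ X') (g : B ⟶ B') : extProd X B ⟶ extProd X' B' where
  app p :=
    { app := fun k => TypeCat.ofHom fun x => (f.app p x.1, g.app k x.2)
      naturality := by
        intro k l φ
        ext x
        obtain ⟨x₁, x₂⟩ := x
        exact congrArg (Prod.mk (f.app p x₁)) (NatTrans.naturality_apply g φ x₂) }
  naturality p q θ := by
    ext k x
    obtain ⟨x₁, x₂⟩ := x
    exact congrArg (fun t => (t, g.app k x₂)) (NatTrans.naturality_apply f θ x₁)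

/-- The subcomplex `Σ(m)` of the standard simplex `h(m)`: the union of the principal edges. -/
def spine (m : ℕ) : (Δ[m] : SSet.{u}).Subcomplex :=
  ⨆ i : Fin m, SSet.Subcomplex.range (SSet.stdSimplex.map (SimplexCategory.mkOfSucc i))

/-- The bisimplicial set `U = (Σ(m) ⊗ B) ∪ (h(m) ⊗ B')`, glued along `Σ(m) ⊗ B'`, for a map
`j : B' ⟶ B` of simplicial sets. -/
def attachU (m : ℕ) {B' B : SSet.{u}} (j : B' ⟶ B) : BiSSet.{u} :=
  pushout (extProdMap (𝟙 (spine.{u} m).toSSet) j) (extProdMap (spine.{u} m).ι (𝟙 B'))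

/-- The bisimplicial set `V = h(m) ⊗ B`. -/
def attachV (m : ℕ) (B : SSet.{u}) : BiSSet.{u} := extProd Δ[m] B

/-- The canonical map `U ⟶ V`. -/
def attachUV (m : ℕ) {B' B : SSet.{u}} (j : B' ⟶ B) : attachU m j ⟶ attachV m B :=
  pushout.desc (extProdMap (spine.{u} m).ι (𝟙 B)) (extProdMap (𝟙 Δ[m]) j) (by
    ext p k x
    rfl)

/-- The map `h(m) ⊗ B ⟶ A` corresponding to a map `B ⟶ A_{m/}`. -/
def simplexHom {A : BiSSet.{u}} {m : ℕ} {B : SSet.{u}} (α : B ⟶ A.obj (op ⦋m⦌)) :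
    extProd Δ[m] B ⟶ A where
  app p :=
    { app := fun k => TypeCat.ofHom fun x =>
        (A.map (SSet.stdSimplex.objEquiv x.1).op).app k (α.app k x.2)
      naturality := by
        intro k l φ
        ext x
        exact NatTrans.naturality_apply
          (α ≫ A.map (SSet.stdSimplex.objEquiv x.1).op) φ x.2 }
  naturality p q θ := by
    ext k x
    change (A.map (SSet.stdSimplex.objEquiv (Δ[m].map θ x.1)).op).app k (α.app k x.2) =
      (A.map θ).app k ((A.map (SSet.stdSimplex.objEquiv x.1).op).app k (α.app k x.2))
    have h : (SSet.stdSimplex.objEquiv (Δ[m].map θ x.1)).op =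
        (SSet.stdSimplex.objEquiv x.1).op ≫ θ := rfl
    rw [h, A.map_comp]
    rfl

lemma factorsThroughEdge_of_mem_spine {m : ℕ} {p : SimplexCategoryᵒᵖ}
    {s : (Δ[m] : SSet.{u}).obj p} (hs : s ∈ (spine.{u} m).obj p) :
    FactorsThroughEdge (SSet.stdSimplex.objEquiv s) := by
  simp only [spine, Subfunctor.iSup_obj, Set.mem_iUnion] at hs
  obtain ⟨i, t, rfl⟩ := hs
  exact ⟨i, SSet.stdSimplex.objEquiv t, rfl⟩

/-- The map `Σ(m) ⊗ B ⟶ A` corresponding to a map `B ⟶ A_{1/} ×_{A_0} ⋯ ×_{A_0} A_{1/}`. -/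
def spineHom {A : BiSSet.{u}} {m : ℕ} {B : SSet.{u}} (β : B ⟶ segalProduct A m) :
    extProd (spine.{u} m).toSSet B ⟶ A where
  app p :=
    { app := fun k => TypeCat.ofHom fun x =>
        (edgeMap A _ (factorsThroughEdge_of_mem_spine x.1.2)).app k (β.app k x.2)
      naturality := by
        intro k l φ
        ext x
        exact NatTrans.naturality_apply
          (β ≫ edgeMap A _ (factorsThroughEdge_of_mem_spine x.1.2)) φ x.2 }
  naturality p q θ := by
    ext k x
    exact congrArg (fun t => t.app k (β.app k x.2))
      (edgeMap_map A _ (factorsThroughEdge_of_mem_spine x.1.2) θ.unop).symm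

/-- The map `U ⟶ A` corresponding to a commutative square from `B' ⟶ B` to the Segal map of `A`. -/
def attachHom {A : BiSSet.{u}} {m : ℕ} {B' B : SSet.{u}} (j : B' ⟶ B)
    (α : B' ⟶ A.obj (op ⦋m⦌)) (β : B ⟶ segalProduct A m) (w : α ≫ segalMap A m = j ≫ β) :
    attachU m j ⟶ A :=
  pushout.desc (spineHom β) (simplexHom α) (by
    ext p k x
    have hs := factorsThroughEdge_of_mem_spine x.1.2
    have h := congrArg (fun t => (t ≫ edgeMap A _ hs).app k x.2) w
    simp only [Category.assoc, segalMap_edgeMap] at h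
    exact h.symm)

/-- The map `U ⟶ A` attaching the copies of `C` in `Arr(A,m)`, where `U` is formed with
`a : A_{m/} ⟶ C`; it corresponds to the square formed by `a`, the Segal map, the identity of
`A_{m/}` and `b`. -/
def arrAttach (A : BiSSet.{u}) (m : ℕ) : attachU m (cylIncl A m) ⟶ A :=
  attachHom (cylIncl A m) (𝟙 _) (cylProj A m)
    (by rw [Category.id_comp, cylIncl_cylProj])

/-- The map `V = h(m) ⊗ C ⟶ Arr(A,m)` corresponding to the map `C ⟶ Arr(A,m)_{m/}` attached to
the identity of `m`. -/
def arrCell (A : BiSSet.{u}) (m : ℕ) : attachV m (cyl A m) ⟶ arr A m :=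
  simplexHom (A := arr A m) (arrCyl A m (𝟙 ⦋m⦌))

end SegalPrecat

end

/-! A map out of `h(m) ⊗ C` is a natural family of maps `C ⟶ Z_{p/}` indexed by the maps `p ⟶ m`.
Compatibility on `U` with a map `A ⟶ Z` fixes the members whose index factors through a principal
edge, and fixes the restriction along `a` of all the others. What remains free is exactly the copies
of `C` glued in `Arr(A,m)`; this is the pushout square `isPushout_arr`.

The diagonal preserves pushouts and turns `⊗` into the product, so it sends `U ⟶ V` to the
pushout-product of the spine inclusion with the monomorphism `a`. The spine inclusion is anodyne
(`anodyneExtensions_spine_ι`, by a regular pairing of the missing simplices). Hence the diagonal of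
`U ⟶ V` is anodyne, and so is its cobase change, the diagonal of `A ⟶ Arr(A,m)`.

On the topological side, the realization of a horn inclusion is a retract of a cylinder inclusion `Y
⟶ Y × [0,1]`, so it lifts against Hurewicz fibrations. By the adjunction with the singular complex,
the realization of every anodyne map does too (`hurewiczAcyclic_of_anodyneExtensions`). Lifting
against the endpoint fibration of the mapping path space exhibits such a map as the inclusion of a
strong deformation retract, which gives the embedding and the weak equivalence together.

The other claims are checked degreewise: every map `0 ⟶ m` factors through a principal edge, so
nothing is glued to `A_{0/}`, and coproducts and pushouts of monomorphisms are monomorphisms. -/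

noncomputable section

namespace SegalPrecat

/-! ### Strong deformation retracts -/

section DeformationRetract

variable {X Y : Type u} [TopologicalSpace X] [TopologicalSpace Y]

/-- The continuous map `i` is the inclusion of a strong deformation retract. -/
def IsStrongDeformationRetract (i : C(X, Y)) : Prop :=
  ∃ (r : C(Y, X)) (H : C(Y × unitInterval, Y)), (∀ x, r (i x) = x) ∧
    (∀ y, H (y, 0) = i (r y)) ∧ (∀ y, H (y, 1) = y) ∧ ∀ x t, H (i x, t) = i x

lemma IsStrongDeformationRetract.isEmbedding {i : C(X, Y)} (hi : IsStrongDeformationRetract i) :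
    Topology.IsEmbedding i := by
  obtain ⟨r, H, hr, -⟩ := hi
  exact Topology.IsEmbedding.of_leftInverse hr r.continuous i.continuous

lemma IsStrongDeformationRetract.isWeakEquivalence {i : C(X, Y)}
    (hi : IsStrongDeformationRetract i) : IsWeakEquivalence i := by
  obtain ⟨r, H, hr, h0, h1, hH⟩ := hi
  have hri : r.comp i = ContinuousMap.id X := by ext x; exact hr x
  refine ⟨⟨Function.LeftInverse.injective (g := pi0Map r) ?_, ?_⟩, fun n _ x => ⟨?_, ?_⟩⟩
  · intro a
    induction a using Quotient.inductionOn with | _ x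
    exact congrArg ZerothHomotopy.mk (hr x)
  · intro b
    induction b using Quotient.inductionOn with | _ y
    refine ⟨ZerothHomotopy.mk (r y), ?_⟩
    refine ZerothHomotopy.sound ⟨⟨fun t => H (y, t), by fun_prop⟩, h0 y, h1 y⟩
  · intro a b hab
    induction a using Quotient.inductionOn with | _ α
    induction b using Quotient.inductionOn with | _ β
    refine Quotient.sound ?_
    -- The retraction is applied to the underlying homotopy rather than through `piMap r`, whose
    -- base point would be `r (i x)`, equal to `x` only propositionally.
    have h : GenLoop.Homotopic (genLoopMap i n x α) (genLoopMap i n x β) := Quotient.exact hab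
    have h' := h.map fun G => G.compContinuousMap r
    have hα : ∀ γ : GenLoop (Fin n) X x, r.comp (genLoopMap i n x γ).1 = γ.1 := fun γ => by
      ext y; exact hr _
    rw [hα, hα] at h'
    exact h'
  · intro b
    induction b using Quotient.inductionOn with | _ γ
    refine ⟨Quotient.mk _ ⟨r.comp γ.1, fun y hy => ?_⟩, Quotient.sound ⟨?_⟩⟩
    · exact (congrArg r (γ.2 y hy)).trans (hr x)
    -- The deformation carries `i ∘ r ∘ γ` to `γ`. It is relative to the boundary because `H` is
    -- stationary on the image of `i`.
    · refine ⟨⟨⟨fun p => H (γ.1 p.2, p.1), by fun_prop⟩, fun y => h0 _, fun y => h1 _⟩, ?_⟩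
      intro t y hy
      have hγ : γ.1 y = i x := γ.2 y hy
      change H (γ.1 y, t) = i (r (γ.1 y))
      rw [hγ, hH, hr]

end DeformationRetract

/-! ### Maps with the left lifting property with respect to Hurewicz fibrations -/

/-- The inclusion of a space as the end `0` of its cylinder. -/
def cylinderIncl (Y : TopCat.{u}) : Y ⟶ TopCat.of (Y × unitInterval) :=
  TopCat.ofHom ⟨fun y => (y, 0), by fun_prop⟩

/-- Hurewicz fibrations of topological spaces. -/
def hurewiczFibrations : MorphismProperty TopCat.{u} :=
  (MorphismProperty.ofHoms cylinderIncl.{u}).rlp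

lemma hurewiczFibrations_of_lift {E B : TopCat.{u}} (p : E ⟶ B)
    (h : ∀ (Y : TopCat.{u}) (e : C(Y, E)) (b : C(Y × unitInterval, B)),
      (∀ y, p (e y) = b (y, 0)) → ∃ l : C(Y × unitInterval, E),
        (∀ y, l (y, 0) = e y) ∧ ∀ z, p (l z) = b z) :
    hurewiczFibrations p := by
  rintro _ _ _ ⟨_⟩
  refine ⟨fun {e b} sq => ?_⟩
  obtain ⟨l, hl, hl'⟩ := h _ e.hom b.hom fun y => ConcreteCategory.congr_hom sq.w y
  refine ⟨⟨⟨TopCat.ofHom l, ?_, ?_⟩⟩⟩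
  · ext y
    exact hl y
  · ext z
    exact hl' z

/-! ### The endpoint fibration of the mapping path space. -/

section PathSpace

variable {X Y : Type u} [TopologicalSpace X] [TopologicalSpace Y] (i : C(X, Y))

/-- The space of pairs of a point `x` and a path starting at `i x`. -/
abbrev MappingPathSpace : Type u := {q : X × C(unitInterval, Y) // q.2 0 = i q.1}

/-- The end point of a path in the mapping path space. -/
def MappingPathSpace.endpoint : C(MappingPathSpace i, Y) :=
  ⟨fun q => q.1.2 1, by fun_prop⟩

/-- A motion of the end point is lifted by prolonging the path along that motion. -/
lemma hurewiczFibrations_endpoint :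
    hurewiczFibrations (TopCat.ofHom (MappingPathSpace.endpoint i)) := by
  refine hurewiczFibrations_of_lift _ fun Z e b heb => ?_
  have heb' : ∀ z, (e z).1.2 1 = b (z, 0) := heb
  -- The path `e z` followed by `b (z, ·)` on `[0, s]` has total length `1 + s`; it is traversed at
  -- constant speed `1 + s`.
  let F : (Z × unitInterval) × unitInterval → Y := fun w =>
    if ((1 : ℝ) + w.1.2) * w.2 ≤ 1 then
      (e w.1.1).1.2 (Set.projIcc 0 1 zero_le_one (((1 : ℝ) + w.1.2) * w.2))
    else b (w.1.1, Set.projIcc 0 1 zero_le_one (((1 : ℝ) + w.1.2) * w.2 - 1))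
  have hF : Continuous F := by
    refine Continuous.if_le ?_ ?_ (by fun_prop) (by fun_prop) ?_
    · have h1 : Continuous fun w : (Z × unitInterval) × unitInterval => (e w.1.1).1.2 := by
        fun_prop
      exact h1.eval (continuous_projIcc.comp (by fun_prop))
    · refine b.continuous.comp (Continuous.prodMk (by fun_prop) ?_)
      exact continuous_projIcc.comp (by fun_prop)
    · intro w hw
      rw [hw, sub_self, Set.projIcc_right, Set.projIcc_left]
      exact heb' _
  have hstart : ∀ w : Z × unitInterval, F (w, 0) = i (e w.1).1.1 := by
    intro w
    have h := (e w.1).2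
    simp only [F, Set.Icc.coe_zero, mul_zero, zero_le_one, if_true, Set.projIcc_left]
    exact h
  let G : C(Z × unitInterval, C(unitInterval, Y)) := ContinuousMap.curry ⟨F, hF⟩
  refine ⟨⟨fun w => ⟨((e w.1).1.1, G w), hstart w⟩, by fun_prop⟩, fun z => ?_, fun w => ?_⟩
  · refine Subtype.ext (Prod.ext rfl ?_)
    ext t
    change F ((z, 0), t) = (e z).1.2 t
    simp only [F, Set.Icc.coe_zero, add_zero, one_mul, t.2.2, if_true, Set.projIcc_val]
  · change F (w, 1) = b w
    obtain ⟨z, s⟩ := w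
    -- At `t = 1` the second branch of `F` is reached only for `s > 0`; for `s = 0` the value is the
    -- end point of `e z`.
    by_cases hs : s = 0
    · subst hs
      simp only [F, Set.Icc.coe_zero, add_zero, one_mul, Set.Icc.coe_one, le_refl, if_true,
        Set.projIcc_right]
      exact heb' z
    · have hs' : ¬ ((1 : ℝ) + s) * (1 : unitInterval) ≤ 1 := by
        have : (0 : ℝ) < s := unitInterval.pos_iff_ne_zero.2 hs
        simpa using this
      simp only [F, hs', if_false]
      congr 2
      simp

end PathSpace

/-- The maps with the left lifting property with respect to Hurewicz fibrations. -/
def hurewiczAcyclic : MorphismProperty TopCat.{u} := hurewiczFibrations.llp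

lemma cylinderIncl_mem (Y : TopCat.{u}) : hurewiczAcyclic (cylinderIncl Y) :=
  MorphismProperty.le_llp_rlp _ _ ⟨Y⟩

/-- Lift the identity of `Y` through the endpoint fibration, extending the constant paths on `X`.
The lift assigns to `y` a point `r y` and a path from `i (r y)` to `y`. -/
lemma hurewiczAcyclic.isStrongDeformationRetract {X Y : TopCat.{u}} {i : X ⟶ Y}
    (hi : hurewiczAcyclic i) : IsStrongDeformationRetract i.hom := by
  have := hi _ (hurewiczFibrations_endpoint i.hom)
  let c : C(X, MappingPathSpace i.hom) :=
    ⟨fun x => ⟨(x, ContinuousMap.const _ (i x)), rfl⟩, by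
      have : Continuous fun x : X => ContinuousMap.const unitInterval (i x) :=
        ContinuousMap.continuous_const'.comp i.hom.continuous
      fun_prop⟩
  have sq : CommSq (TopCat.ofHom c) i (TopCat.ofHom (MappingPathSpace.endpoint i.hom)) (𝟙 Y) :=
    ⟨by ext x; rfl⟩
  let l : C(Y, MappingPathSpace i.hom) := sq.lift.hom
  have hl : ∀ x, l (i x) = c x := fun x => ConcreteCategory.congr_hom sq.fac_left x
  have hl' : ∀ y, (l y).1.2 1 = y := fun y => ConcreteCategory.congr_hom sq.fac_right y
  refine ⟨⟨fun y => (l y).1.1, by fun_prop⟩, ⟨fun w => (l w.1).1.2 w.2, ?_⟩, fun x => ?_,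
    fun y => (l y).2, hl', fun x t => ?_⟩
  · have h1 : Continuous fun w : Y × unitInterval => (l w.1).1.2 := by fun_prop
    exact h1.eval continuous_snd
  · exact congrArg (fun q => q.1.1) (hl x)
  · exact congrArg (fun q => q.1.2 t) (hl x)

/-- The data present `i` as a retract of the cylinder inclusion of `Y`, by `y ↦ (y, φ y)` and `K`,
and left lifting properties pass to retracts. -/
lemma hurewiczAcyclic_of_retraction {X Y : TopCat.{u}} (i : X ⟶ Y) (r : Y ⟶ X) (hr : i ≫ r = 𝟙 X)
    (φ : C(Y, unitInterval)) (K : C(Y × unitInterval, Y)) (hφ : ∀ x, φ (i x) = 0)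
    (h0 : ∀ y, K (y, 0) = i (r y)) (h1 : ∀ y, K (y, φ y) = y) : hurewiczAcyclic i := by
  intro E B p hp
  have := cylinderIncl_mem Y p hp
  let h : RetractArrow i (cylinderIncl Y) :=
    { i := Arrow.homMk i (TopCat.ofHom ⟨fun y => (y, φ y), by fun_prop⟩) (by
        ext x
        exact Prod.ext rfl (hφ x).symm)
      r := Arrow.homMk r (TopCat.ofHom K) (by
        ext y
        exact (h0 y).symm)
      retract := by
        ext x
        · exact ConcreteCategory.congr_hom hr x
        · exact h1 x }
  exact h.leftLiftingProperty p

/-! ### Realizations of horns -/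

lemma stdSimplex_map_eq_self {X : Type*} [Fintype X] (f : X → X) (z : stdSimplex ℝ X)
    (hf : ∀ i, z i ≠ 0 → f i = i) : stdSimplex.map f z = z := by
  classical
  ext i
  rw [stdSimplex.map_coe, FunOnFinite.linearMap_apply_apply, Finset.sum_filter,
    ← Finset.sum_ite_eq' Finset.univ i (fun j => z j) |>.trans (if_pos (Finset.mem_univ i))]
  refine Finset.sum_congr rfl fun j _ => ?_
  by_cases hj : z j = 0
  · simp [hj]
  · rw [hf j hj]

lemma exists_stdSimplex_map_eq {X Y : Type*} [Fintype X] [Fintype Y] (f : X → Y)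
    (z : stdSimplex ℝ Y) (hz : ∀ i, z i ≠ 0 → i ∈ Set.range f) :
    ∃ w : stdSimplex ℝ X, stdSimplex.map f w = z := by
  -- `Function.invFun` needs `X` nonempty. This follows since the coordinates of `z` sum to `1`, so
  -- one of them is nonzero.
  obtain ⟨i, hi⟩ : ∃ i, z i ≠ 0 := by
    by_contra! h
    have := stdSimplex.sum_eq_one z
    simp [h] at this
  have : Nonempty X := ⟨(hz i hi).choose⟩
  refine ⟨stdSimplex.map (Function.invFun f) z, ?_⟩
  rw [stdSimplex.map_comp_apply]
  exact stdSimplex_map_eq_self _ _ fun i hi => Function.invFun_eq (hz i hi)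

lemma stdSimplex_map_apply_eq_zero {X Y : Type*} [Fintype X] [Fintype Y] (f : X → Y)
    (w : stdSimplex ℝ X) (i : Y) (hi : i ∉ Set.range f) : stdSimplex.map f w i = 0 := by
  classical
  rw [stdSimplex.map_coe, FunOnFinite.linearMap_apply_apply]
  refine Finset.sum_eq_zero fun j hj => ?_
  exact (hi ⟨j, by simpa using hj⟩).elim

/-! ### Pushing a simplex onto a horn in barycentric coordinates. -/

section HornPush

variable {n : ℕ} (k : Fin (n + 2))

lemma erase_nonempty : (Finset.univ.erase k).Nonempty := by
  obtain ⟨j, hj⟩ := exists_ne k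
  exact ⟨j, by simpa using hj⟩

/-- The least of the barycentric coordinates other than the `k`-th one. -/
def hornDist (y : stdSimplex ℝ (Fin (n + 2))) : ℝ :=
  (Finset.univ.erase k).inf' (erase_nonempty k) fun i => y i

lemma continuous_stdSimplex_apply {X : Type*} [Fintype X] (i : X) :
    Continuous fun y : stdSimplex ℝ X => y i :=
  (continuous_apply i).comp continuous_subtype_val

lemma continuous_hornDist : Continuous (hornDist k) :=
  Continuous.finset_inf'_apply _ fun i _ => continuous_stdSimplex_apply i

lemma hornDist_le (y : stdSimplex ℝ (Fin (n + 2))) (i : Fin (n + 2)) (hi : i ≠ k) :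
    hornDist k y ≤ y i :=
  Finset.inf'_le _ (by simpa using hi)

lemma hornDist_nonneg (y : stdSimplex ℝ (Fin (n + 2))) : 0 ≤ hornDist k y :=
  (Finset.le_inf'_iff _ _).2 fun _ _ => stdSimplex.zero_le y _

lemma hornDist_le_one (y : stdSimplex ℝ (Fin (n + 2))) : hornDist k y ≤ 1 := by
  obtain ⟨j, hj⟩ := exists_ne k
  exact (hornDist_le k y j hj).trans (stdSimplex.le_one y j)

lemma exists_eq_hornDist (y : stdSimplex ℝ (Fin (n + 2))) : ∃ j, j ≠ k ∧ y j = hornDist k y := by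
  obtain ⟨j, hj, h⟩ := Finset.exists_mem_eq_inf' (erase_nonempty k) fun i => y i
  exact ⟨j, by simpa using hj, h.symm⟩

/-- Moving a point of the simplex towards the `k`-th vertex by subtracting the same number from
all other barycentric coordinates: the largest possible number, less `t`. -/
def hornPush (w : stdSimplex ℝ (Fin (n + 2)) × unitInterval) : stdSimplex ℝ (Fin (n + 2)) :=
  -- The amount is subtracted from all `n + 2` coordinates, the `k`-th included, so `n + 2` times it
  -- is returned to the `k`-th.
  ⟨fun i => w.1 i - max (hornDist k w.1 - w.2) 0 +
      if i = k then ((n : ℝ) + 2) * max (hornDist k w.1 - w.2) 0 else 0, by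
    have h0 : 0 ≤ max (hornDist k w.1 - w.2) 0 := le_max_right _ _
    have h1 : max (hornDist k w.1 - w.2) 0 ≤ hornDist k w.1 :=
      max_le (by linarith [w.2.2.1]) (hornDist_nonneg k w.1)
    generalize max (hornDist k w.1 - w.2) 0 = s at h0 h1
    constructor
    · intro i
      dsimp only
      split_ifs with hi
      · have := stdSimplex.zero_le w.1 i
        have : 0 ≤ (n : ℝ) * s := by positivity
        linarith
      · linarith [hornDist_le k w.1 i hi]
    · rw [Finset.sum_add_distrib, Finset.sum_sub_distrib, Finset.sum_ite_eq']
      have := stdSimplex.sum_eq_one w.1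
      simp [this]⟩

lemma continuous_hornPush : Continuous (hornPush k) := by
  have h1 : ∀ i, Continuous fun w : stdSimplex ℝ (Fin (n + 2)) × unitInterval => w.1 i :=
    fun i => (continuous_stdSimplex_apply i).comp continuous_fst
  have h2 : Continuous fun w : stdSimplex ℝ (Fin (n + 2)) × unitInterval => hornDist k w.1 :=
    (continuous_hornDist k).comp continuous_fst
  refine Continuous.subtype_mk (continuous_pi fun i => ?_) _
  have := h1 i
  split_ifs <;> fun_prop

lemma hornPush_apply_of_ne (w : stdSimplex ℝ (Fin (n + 2)) × unitInterval) (i : Fin (n + 2))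
    (hi : i ≠ k) : hornPush k w i = w.1 i - max (hornDist k w.1 - w.2) 0 := by
  change w.1 i - _ + (if i = k then _ else 0) = _
  rw [if_neg hi, add_zero]

lemma hornPush_eq_self (w : stdSimplex ℝ (Fin (n + 2)) × unitInterval)
    (hw : hornDist k w.1 ≤ w.2) : hornPush k w = w.1 := by
  have h : max (hornDist k w.1 - w.2) 0 = 0 := max_eq_right (by linarith)
  ext i
  change w.1 i - max (hornDist k w.1 - w.2) 0 + (if i = k then _ else 0) = _
  rw [h]
  simp

lemma exists_hornPush_eq_zero (y : stdSimplex ℝ (Fin (n + 2))) :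
    ∃ j, j ≠ k ∧ hornPush k (y, 0) j = 0 := by
  obtain ⟨j, hj, h⟩ := exists_eq_hornDist k y
  refine ⟨j, hj, ?_⟩
  rw [hornPush_apply_of_ne k _ j hj]
  simp [h, hornDist_nonneg]

end HornPush

/-! ### Transport of the push to realizations of simplices and horns. -/

section Horn

lemma toTop_map_comp_apply {X Y Z : SSet.{u}} (f : X ⟶ Y) (g : Y ⟶ Z) (x : SSet.toTop.obj X) :
    SSet.toTop.map (f ≫ g) x = SSet.toTop.map g (SSet.toTop.map f x) := by
  rw [Functor.map_comp]
  rfl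

lemma toTop_map_map_comp_apply {l m n : SimplexCategory} (f : l ⟶ m) (g : m ⟶ n)
    (x : |SSet.stdSimplex.{u}.obj l|) :
    SSet.toTop.map (SSet.stdSimplex.map (f ≫ g)) x =
      SSet.toTop.map (SSet.stdSimplex.map g) (SSet.toTop.map (SSet.stdSimplex.map f) x) := by
  rw [SSet.stdSimplex.map_comp, toTop_map_comp_apply]

lemma exists_δ_comp_eq_id {n : ℕ} (j : Fin (n + 2)) :
    ∃ s : ⦋n + 1⦌ ⟶ ⦋n⦌, SimplexCategory.δ j ≫ s = 𝟙 _ := by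
  obtain ⟨i, rfl⟩ | rfl := j.eq_castSucc_or_eq_last
  · exact ⟨SimplexCategory.σ i, SimplexCategory.δ_comp_σ_self⟩
  · exact ⟨SimplexCategory.σ (Fin.last n), SimplexCategory.δ_comp_σ_succ⟩

/-- A retraction of the `j`-th coface map. -/
def cofaceRetraction {n : ℕ} (j : Fin (n + 2)) : (Δ[n + 1] : SSet.{u}) ⟶ Δ[n] :=
  SSet.stdSimplex.map (exists_δ_comp_eq_id j).choose

lemma δ_cofaceRetraction {n : ℕ} (j : Fin (n + 2)) :
    SSet.stdSimplex.δ j ≫ cofaceRetraction.{u} j = 𝟙 _ := by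
  refine (SSet.stdSimplex.map_comp _ _).symm.trans ?_
  rw [(exists_δ_comp_eq_id j).choose_spec]
  exact CategoryTheory.Functor.map_id (uliftYoneda.{u}) _

/-- A barycentric coordinate of a point of the realization of a standard simplex. -/
def coord {n : ℕ} (y : |(Δ[n] : SSet.{u})|) (j : Fin (n + 1)) : ℝ :=
  (⦋n⦌.toTopHomeo y : stdSimplex ℝ (Fin (n + 1))) j

lemma exists_toTop_map_eq {m n : ℕ} (f : ⦋m⦌ ⟶ ⦋n⦌) (y : |(Δ[n] : SSet.{u})|)
    (hy : ∀ i, coord y i ≠ 0 → i ∈ Set.range f.toOrderHom) :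
    ∃ w, SSet.toTop.map (SSet.stdSimplex.map f) w = y := by
  obtain ⟨w, hw⟩ := exists_stdSimplex_map_eq f.toOrderHom (⦋n⦌.toTopHomeo y) hy
  refine ⟨⦋m⦌.toTopHomeo.symm w, ⦋n⦌.toTopHomeo.injective ?_⟩
  rw [SimplexCategory.toTopHomeo_naturality_apply, Homeomorph.apply_symm_apply]
  exact hw

lemma coord_toTop_map_δ {n : ℕ} (j : Fin (n + 2)) (w : |(Δ[n] : SSet.{u})|) :
    coord (SSet.toTop.map (SSet.stdSimplex.δ j) w) j = 0 := by
  have h := SimplexCategory.toTopHomeo_naturality_apply (SimplexCategory.δ j) w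
  change (⦋n + 1⦌.toTopHomeo (SSet.toTop.map (SSet.stdSimplex.map (SimplexCategory.δ j)) w) :
    stdSimplex ℝ (Fin (n + 2))) j = 0
  rw [h]
  refine stdSimplex_map_apply_eq_zero _ _ _ ?_
  rintro ⟨i, hi⟩
  exact Fin.succAbove_ne j i hi

lemma exists_toTop_map_δ_eq {n : ℕ} (j : Fin (n + 2)) (y : |(Δ[n + 1] : SSet.{u})|)
    (hy : coord y j = 0) : ∃ w, SSet.toTop.map (SSet.stdSimplex.δ j) w = y := by
  refine exists_toTop_map_eq (SimplexCategory.δ j) y fun i hi => ?_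
  have hij : i ≠ j := by rintro rfl; exact hi hy
  exact Fin.exists_succAbove_eq hij

variable {n : ℕ} (k : Fin (n + 2))

/-- The map to the horn which is the retraction to the `j`-th face on the simplex. -/
def hornFaceRetraction (j : Fin (n + 2)) (hj : j ≠ k) :
    |(Δ[n + 1] : SSet.{u})| ⟶ |(Λ[n + 1, k] : SSet.{u})| :=
  SSet.toTop.map (cofaceRetraction j ≫ SSet.horn.ι k j hj)

lemma hornFaceRetraction_δ (j : Fin (n + 2)) (hj : j ≠ k) (w : |(Δ[n] : SSet.{u})|) :
    hornFaceRetraction k j hj (SSet.toTop.map (SSet.stdSimplex.δ j) w) =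
      SSet.toTop.map (SSet.horn.ι k j hj) w := by
  rw [hornFaceRetraction, ← toTop_map_comp_apply, ← Category.assoc, δ_cofaceRetraction,
    Category.id_comp]

/-- The point lies on the codimension-two face omitting `j` and `l`, where the two faces of the horn
agree by the simplicial identities. -/
lemma hornFaceRetraction_eq_of_lt (j l : Fin (n + 2)) (hj : j ≠ k) (hl : l ≠ k) (hjl : j < l)
    (y : |(Δ[n + 1] : SSet.{u})|) (hyj : coord y j = 0) (hyl : coord y l = 0) :
    hornFaceRetraction k j hj y = hornFaceRetraction k l hl y := by
  -- In a one-dimensional simplex there are no two distinct indices different from `k`.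
  obtain _ | n := n
  · omega
  have hrel : SimplexCategory.δ (l.pred (Fin.ne_zero_of_lt hjl)) ≫ SimplexCategory.δ j =
      SimplexCategory.δ (j.castPred (Fin.ne_last_of_lt hjl)) ≫ SimplexCategory.δ l := by
    obtain ⟨j, rfl⟩ := j.eq_castSucc_of_ne_last (Fin.ne_last_of_lt hjl)
    obtain ⟨l, rfl⟩ := l.eq_succ_of_ne_zero (Fin.ne_zero_of_lt hjl)
    simp only [Fin.pred_succ, Fin.castPred_castSucc]
    exact (SimplexCategory.δ_comp_δ (by grind)).symm
  obtain ⟨v, hv⟩ := exists_toTop_map_eq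
    (SimplexCategory.δ (l.pred (Fin.ne_zero_of_lt hjl)) ≫ SimplexCategory.δ j) y (fun i hi => by
      have hij : i ≠ j := by rintro rfl; exact hi hyj
      have hil : i ≠ l := by rintro rfl; exact hi hyl
      obtain ⟨i', rfl⟩ := Fin.exists_succAbove_eq hij
      have hi' : i' ≠ l.pred (Fin.ne_zero_of_lt hjl) := by
        rintro rfl
        exact hil (Fin.succAbove_pred_of_lt _ _ hjl)
      obtain ⟨i'', rfl⟩ := Fin.exists_succAbove_eq hi'
      exact ⟨i'', rfl⟩)
  have h1 : y = SSet.toTop.map (SSet.stdSimplex.δ j)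
      (SSet.toTop.map (SSet.stdSimplex.δ (l.pred (Fin.ne_zero_of_lt hjl))) v) := by
    exact hv.symm.trans (toTop_map_map_comp_apply _ _ v)
  have h2 : y = SSet.toTop.map (SSet.stdSimplex.δ l)
      (SSet.toTop.map (SSet.stdSimplex.δ (j.castPred (Fin.ne_last_of_lt hjl))) v) := by
    rw [← hv, hrel]
    exact toTop_map_map_comp_apply _ _ v
  have hc := (SSet.horn.isCompatible_iff _).1
    (SSet.horn.IsCompatible.of_hom (𝟙 (Λ[n + 2, k] : SSet.{u}))) j l hj hl hjl
  simp only [Category.comp_id] at hc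
  conv_lhs => rw [h1]
  conv_rhs => rw [h2]
  rw [hornFaceRetraction_δ, hornFaceRetraction_δ, ← toTop_map_comp_apply, hc,
    toTop_map_comp_apply]

lemma hornFaceRetraction_eq (j l : Fin (n + 2)) (hj : j ≠ k) (hl : l ≠ k)
    (y : |(Δ[n + 1] : SSet.{u})|) (hyj : coord y j = 0) (hyl : coord y l = 0) :
    hornFaceRetraction k j hj y = hornFaceRetraction k l hl y := by
  rcases lt_trichotomy j l with h | rfl | h
  · exact hornFaceRetraction_eq_of_lt k j l hj hl h y hyj hyl
  · rfl
  · exact (hornFaceRetraction_eq_of_lt k l j hl hj h y hyl hyj).symm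

/-- Realization is a left adjoint, so the faces of a horn stay jointly epimorphic. -/
lemma toTop_map_horn_hom_ext {Z : TopCat.{u}} {f g : |(Λ[n + 1, k] : SSet.{u})| ⟶ Z}
    (h : ∀ (j : Fin (n + 2)) (hj : j ≠ k),
      SSet.toTop.map (SSet.horn.ι k j hj) ≫ f = SSet.toTop.map (SSet.horn.ι k j hj) ≫ g) :
    f = g := by
  apply (sSetTopAdj.homEquiv _ _).injective
  refine SSet.horn.hom_ext' fun j hj => ?_
  rw [← Adjunction.homEquiv_naturality_left, ← Adjunction.homEquiv_naturality_left, h]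

/-- The deformation `hornPush` on the realization of the standard simplex. -/
def toTopHornPush : C(|(Δ[n + 1] : SSet.{u})| × unitInterval, |(Δ[n + 1] : SSet.{u})|) :=
  ⟨fun w => ⦋n + 1⦌.toTopHomeo.symm (hornPush k (⦋n + 1⦌.toTopHomeo w.1, w.2)),
    ⦋n + 1⦌.toTopHomeo.symm.continuous.comp ((continuous_hornPush k).comp
      (((⦋n + 1⦌.toTopHomeo.continuous.comp continuous_fst)).prodMk continuous_snd))⟩

lemma toTopHornPush_eq_self (y : |(Δ[n + 1] : SSet.{u})|) (t : unitInterval)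
    (h : hornDist k (⦋n + 1⦌.toTopHomeo y) ≤ t) : toTopHornPush k (y, t) = y := by
  change ⦋n + 1⦌.toTopHomeo.symm (hornPush k (⦋n + 1⦌.toTopHomeo y, t)) = y
  rw [hornPush_eq_self k _ h]
  exact ⦋n + 1⦌.toTopHomeo.symm_apply_apply y

lemma exists_coord_toTopHornPush (y : |(Δ[n + 1] : SSet.{u})|) :
    ∃ j, j ≠ k ∧ coord (toTopHornPush k (y, 0)) j = 0 := by
  obtain ⟨j, hj, h⟩ := exists_hornPush_eq_zero k (⦋n + 1⦌.toTopHomeo y)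
  refine ⟨j, hj, ?_⟩
  change (⦋n + 1⦌.toTopHomeo (⦋n + 1⦌.toTopHomeo.symm (hornPush k (⦋n + 1⦌.toTopHomeo y, 0))) :
    stdSimplex ℝ (Fin (n + 2))) j = 0
  rw [Homeomorph.apply_symm_apply]
  exact h

/-- At time `0` the push lands on some face `j ≠ k`; following it by the map of that face into the
horn is independent of `j` by `hornFaceRetraction_eq`. This avoids identifying the realized horn
with a subspace of the simplex. -/
lemma exists_hornRetraction :
    ∃ r : |(Δ[n + 1] : SSet.{u})| ⟶ |(Λ[n + 1, k] : SSet.{u})|,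
      ∀ (y : |(Δ[n + 1] : SSet.{u})|) (j : Fin (n + 2)) (hj : j ≠ k),
        coord (toTopHornPush k (y, 0)) j = 0 →
          r y = hornFaceRetraction k j hj (toTopHornPush k (y, 0)) := by
  choose c hc hc' using exists_coord_toTopHornPush.{u} k
  let g : |(Δ[n + 1] : SSet.{u})| → |(Λ[n + 1, k] : SSet.{u})| := fun y =>
    hornFaceRetraction k (c y) (hc y) (toTopHornPush k (y, 0))
  have hg : ∀ (y : |(Δ[n + 1] : SSet.{u})|) (j : Fin (n + 2)) (hj : j ≠ k),
      coord (toTopHornPush k (y, 0)) j = 0 →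
        g y = hornFaceRetraction k j hj (toTopHornPush k (y, 0)) :=
    fun y j hj h => hornFaceRetraction_eq k _ _ _ _ _ (hc' y) h
  have hp : Continuous fun y : |(Δ[n + 1] : SSet.{u})| => toTopHornPush k (y, 0) := by fun_prop
  let F : {j : Fin (n + 2) // j ≠ k} → Set |(Δ[n + 1] : SSet.{u})| := fun j =>
    {y | coord (toTopHornPush k (y, 0)) j.1 = 0}
  have hcont : Continuous g := by
    -- Pasting lemma for the finite closed cover by the sets of points pushed onto a given face.
    refine (locallyFinite_of_finite F).continuous ?_ (fun j => ?_) (fun j => ?_)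
    · exact Set.eq_univ_of_forall fun y => Set.mem_iUnion.2 ⟨⟨c y, hc y⟩, hc' y⟩
    · refine isClosed_eq ?_ continuous_const
      exact (continuous_stdSimplex_apply j.1).comp (⦋n + 1⦌.toTopHomeo.continuous.comp hp)
    · refine ContinuousOn.congr (f := fun y => hornFaceRetraction k j.1 j.2
        (toTopHornPush k (y, 0))) ?_ (fun y hy => hg y j.1 j.2 hy)
      exact ((hornFaceRetraction k j.1 j.2).hom.continuous.comp hp).continuousOn
  exact ⟨TopCat.ofHom ⟨g, hcont⟩, hg⟩

/-- This is `hurewiczAcyclic_of_retraction` with `φ` the function `hornDist` and `K` the push: at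
time `0` points reach the horn, and at time `hornDist` they do not move. -/
lemma hurewiczAcyclic_horn_ι :
    hurewiczAcyclic (SSet.toTop.map (Λ[n + 1, k] : SSet.Subcomplex.{u} _).ι) := by
  obtain ⟨r, hr⟩ := exists_hornRetraction.{u} k
  let φ : C(|(Δ[n + 1] : SSet.{u})|, unitInterval) :=
    ⟨fun y => ⟨hornDist k (⦋n + 1⦌.toTopHomeo y), hornDist_nonneg k _, hornDist_le_one k _⟩,
      ((continuous_hornDist k).comp ⦋n + 1⦌.toTopHomeo.continuous).subtype_mk _⟩
  have hδ : ∀ (j : Fin (n + 2)) (hj : j ≠ k) (w : |(Δ[n] : SSet.{u})|),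
      φ (SSet.toTop.map (SSet.stdSimplex.δ j) w) = 0 := fun j hj w => by
    refine Subtype.ext (le_antisymm ?_ (hornDist_nonneg k _))
    refine (hornDist_le k _ j hj).trans ?_
    exact (coord_toTop_map_δ j w).le
  have hδ' : ∀ (j : Fin (n + 2)) (hj : j ≠ k) (w : |(Δ[n] : SSet.{u})|),
      toTopHornPush k (SSet.toTop.map (SSet.stdSimplex.δ j) w, 0) =
        SSet.toTop.map (SSet.stdSimplex.δ j) w := fun j hj w =>
    toTopHornPush_eq_self k _ _ (congrArg Subtype.val (hδ j hj w)).le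
  refine hurewiczAcyclic_of_retraction _ r ?_ φ (toTopHornPush k) ?_ ?_ ?_
  · refine toTop_map_horn_hom_ext k fun j hj => ?_
    ext w
    change r (SSet.toTop.map Λ[n + 1, k].ι (SSet.toTop.map (SSet.horn.ι k j hj) w)) = _
    rw [← toTop_map_comp_apply, SSet.horn.ι_ι, hr _ j hj, hδ' j hj, hornFaceRetraction_δ]
    · rfl
    · rw [hδ' j hj]
      exact coord_toTop_map_δ j w
  -- The vanishing of `φ` is written as an equality of maps to the cylinder, a target in universe
  -- `u` to which `toTop_map_horn_hom_ext` applies.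
  · have h : SSet.toTop.map Λ[n + 1, k].ι ≫
        TopCat.ofHom (Y := |Δ[n + 1]| × unitInterval) ⟨fun y => (y, φ y), by fun_prop⟩ =
        SSet.toTop.map Λ[n + 1, k].ι ≫ cylinderIncl _ := by
      refine toTop_map_horn_hom_ext k fun j hj => ?_
      rw [← Category.assoc, ← Category.assoc, ← Functor.map_comp, SSet.horn.ι_ι]
      exact TopCat.hom_ext (ContinuousMap.ext fun w =>
        congrArg (Prod.mk (SSet.toTop.map (SSet.stdSimplex.δ j) w)) (hδ j hj w))
    exact fun x => congrArg Prod.snd (ConcreteCategory.congr_hom h x)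
  · intro y
    obtain ⟨j, hj, h⟩ := exists_coord_toTopHornPush k y
    rw [hr y j hj h]
    obtain ⟨w, hw⟩ := exists_toTop_map_δ_eq j _ h
    rw [← hw, hornFaceRetraction_δ, ← toTop_map_comp_apply, SSet.horn.ι_ι]
  · intro y
    exact toTopHornPush_eq_self k _ _ le_rfl

end Horn

open SSet.modelCategoryQuillen in
lemma hurewiczAcyclic_of_anodyneExtensions {X Y : SSet.{u}} {f : X ⟶ Y}
    (hf : SSet.anodyneExtensions f) : hurewiczAcyclic (SSet.toTop.map f) := by
  intro E B p hp
  rw [sSetTopAdj.hasLiftingProperty_iff]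
  rw [SSet.anodyneExtensions_eq_llp_rlp] at hf
  apply hf
  intro _ _ _ hi
  simp only [J, MorphismProperty.iSup_iff] at hi
  obtain ⟨n, ⟨k⟩⟩ := hi
  rw [← sSetTopAdj.hasLiftingProperty_iff]
  exact hurewiczAcyclic_horn_ι k p hp

/-! ### The inclusion of the spine is anodyne -/

lemma mkOfSucc_apply {m : ℕ} (i : Fin m) (y : Fin 2) :
    (((SimplexCategory.Hom.toOrderHom (SimplexCategory.mkOfSucc i) : Fin 2 → Fin (m + 1)) y :
      Fin (m + 1)) : ℕ) = i + y := by
  fin_cases y <;> rfl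

lemma mem_spine_iff_exists {m d : ℕ} (x : (Δ[m] : SSet.{u}) _⦋d⦌) :
    x ∈ (spine.{u} m).obj (op ⦋d⦌) ↔
      ∃ i : Fin m, ∀ j, (i : ℕ) ≤ x j ∧ (x j : ℕ) ≤ i + 1 := by
  simp only [spine, Subfunctor.iSup_obj, Set.mem_iUnion]
  refine exists_congr fun i => ⟨?_, fun h => ?_⟩
  · rintro ⟨t, rfl⟩ j
    have hj : (((SSet.stdSimplex.map (SimplexCategory.mkOfSucc i)).app (op ⦋d⦌) t :
        (Δ[m] : SSet.{u}) _⦋d⦌) j : ℕ) = i + (t : (Δ[1] : SSet.{u}) _⦋d⦌) j :=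
      mkOfSucc_apply i _
    have := ((t : (Δ[1] : SSet.{u}) _⦋d⦌) j).isLt
    omega
  · have hx : ∀ j, (x j : ℕ) - i < 2 := fun j => by have := h j; omega
    refine ⟨SSet.stdSimplex.objMk (n := ⦋1⦌) (m := op ⦋d⦌)
      ⟨fun j => ⟨(x j : ℕ) - i, hx j⟩, fun a b hab => ?_⟩, ?_⟩
    · exact Nat.sub_le_sub_right (SSet.stdSimplex.monotone_apply x hab) _
    · refine SSet.stdSimplex.ext _ _ fun j => Fin.ext ?_
      refine (mkOfSucc_apply i _).trans ?_
      change (i : ℕ) + ((x j : ℕ) - i) = x j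
      have := h j
      omega

/-- Vertices increase, so only the first and last matter. For `m = 0` the spine is empty and the
criterion fails. -/
lemma mem_spine_iff {m d : ℕ} (hm : 1 ≤ m) (x : (Δ[m] : SSet.{u}) _⦋d⦌) :
    x ∈ (spine.{u} m).obj (op ⦋d⦌) ↔ (x (Fin.last d) : ℕ) ≤ x 0 + 1 := by
  rw [mem_spine_iff_exists]
  constructor
  · rintro ⟨i, hi⟩
    have h0 := hi 0
    have h1 := hi (Fin.last d)
    omega
  · intro h
    have hmono : ∀ j, (x 0 : ℕ) ≤ x j ∧ (x j : ℕ) ≤ x (Fin.last d) := fun j =>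
      ⟨SSet.stdSimplex.monotone_apply x (Fin.zero_le j),
        SSet.stdSimplex.monotone_apply x (Fin.le_last j)⟩
    by_cases h0 : (x 0 : ℕ) < m
    · refine ⟨⟨x 0, h0⟩, fun j => ?_⟩
      have := hmono j
      dsimp only
      omega
    -- Here the simplex is constant at the vertex `m`, which starts no edge but ends the last one.
    · refine ⟨⟨m - 1, by omega⟩, fun j => ?_⟩
      have := hmono j
      have := (x j).isLt
      dsimp only
      omega

lemma fin_one_lt_two (d : ℕ) : (1 : Fin (d + 3)) < 2 := by
  rw [Fin.lt_def]
  change 1 % (d + 3) < 2 % (d + 3)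
  rw [Nat.mod_eq_of_lt (by omega), Nat.mod_eq_of_lt (by omega)]
  omega

/-! ### Pairing of the simplices outside the spine. -/

/-- The nondegenerate simplices of dimension at least `2` of the standard simplex whose first two
vertices are consecutive. -/
@[ext]
structure ConsecutiveSimplex (m : ℕ) : Type u where
  /-- the dimension, less `2` -/
  d : ℕ
  /-- the simplex -/
  x : (Δ[m] : SSet.{u}) _⦋d + 2⦌
  strictMono : StrictMono x
  consecutive : (x 1 : ℕ) = x 0 + 1

namespace ConsecutiveSimplex

variable {m : ℕ} (s : ConsecutiveSimplex.{u} m)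

lemma lt_last : (s.x 0 : ℕ) + 1 < s.x (Fin.last _) := by
  rw [← s.consecutive]
  exact s.strictMono (show (1 : Fin (s.d + 3)) < Fin.last _ by simp [Fin.lt_def])

lemma eq_of_mk_eq {s t : ConsecutiveSimplex.{u} m} (h : SSet.S.mk s.x = SSet.S.mk t.x) :
    s = t := by
  obtain ⟨d, x, hx, hx'⟩ := s
  obtain ⟨e, y, hy, hy'⟩ := t
  have hd : d + 2 = e + 2 := SSet.S.dim_eq_of_mk_eq h
  obtain rfl : d = e := by omega
  rw [SSet.S.ext_iff] at h
  subst h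
  rfl

/-- The omitted vertex is recovered as the successor of the first one. -/
lemma eq_of_δ_eq {d : ℕ} {x y : (Δ[m] : SSet.{u}) _⦋d + 2⦌} (hx : (x 1 : ℕ) = x 0 + 1)
    (hy : (y 1 : ℕ) = y 0 + 1)
    (h : (Δ[m] : SSet.{u}).δ (1 : Fin (d + 3)) x = (Δ[m] : SSet.{u}).δ (1 : Fin (d + 3)) y) :
    x = y := by
  have h' : ∀ j : Fin (d + 2), x ((1 : Fin (d + 3)).succAbove j) =
      y ((1 : Fin (d + 3)).succAbove j) := fun j =>
    DFunLike.congr_fun h j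
  have h0 : x 0 = y 0 := h' 0
  refine SSet.stdSimplex.ext _ _ fun j => ?_
  by_cases hj : j = 1
  · subst hj
    apply Fin.ext
    rw [hx, hy, h0]
  · obtain ⟨i, rfl⟩ := Fin.exists_succAbove_eq hj
    exact h' i

/-- A gap after the first vertex leaves room to insert its successor. -/
lemma exists_of_strictMono {d : ℕ} (x : (Δ[m] : SSet.{u}) _⦋d + 1⦌) (hx : StrictMono x)
    (h : (x 0 : ℕ) + 1 < x 1) :
    ∃ s : ConsecutiveSimplex.{u} m, ∃ hd : s.d = d,
      (Δ[m] : SSet.{u}).δ (1 : Fin (s.d + 3)) s.x = hd ▸ x := by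
  let f : Fin (d + 3) → Fin (m + 1) :=
    Fin.cons (x 0) (Fin.cons ⟨x 0 + 1, by have := (x 1).isLt; omega⟩ fun j => x j.succ)
  have hf : StrictMono f := by
    rw [Fin.strictMono_iff_lt_succ]
    intro i
    refine Fin.cases ?_ (fun i => ?_) i
    · exact Nat.lt_succ_self _
    · refine Fin.cases ?_ (fun i => ?_) i
      · exact h
      · exact hx (Fin.castSucc_lt_succ (i := i.succ))
  refine ⟨⟨d, SSet.stdSimplex.objMk (n := ⦋m⦌) (m := op ⦋d + 2⦌) ⟨f, hf.monotone⟩, hf, rfl⟩,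
    rfl, SSet.stdSimplex.ext _ _ fun j => ?_⟩
  change f ((1 : Fin (d + 3)).succAbove j) = x j
  refine Fin.cases rfl (fun i => ?_) j
  have : (1 : Fin (d + 3)).succAbove i.succ = i.succ.succ := by
    apply Fin.succAbove_of_le_castSucc
    simp [Fin.le_def]
  rw [this]
  rfl

end ConsecutiveSimplex

/-- The pairing of the nondegenerate simplices not in the spine: a simplex whose first two vertices
are consecutive is paired with its face which omits the second vertex. -/
def spinePairing {m : ℕ} (hm : 1 ≤ m) : (spine.{u} m).PairingCore where
  ι := ConsecutiveSimplex.{u} m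
  dim s := s.d + 1
  simplex s := s.x
  index s := 1
  nonDegenerate₁ s := (SSet.stdSimplex.mem_nonDegenerate_iff_strictMono _).2 s.strictMono
  nonDegenerate₂ s :=
    SSet.nonDegenerate_δ ((SSet.stdSimplex.mem_nonDegenerate_iff_strictMono _).2 s.strictMono) _
  notMem₁ s := by
    rw [mem_spine_iff hm, not_le]
    exact s.lt_last
  -- Omitting the second vertex changes neither the first nor the last.
  notMem₂ s := by
    rw [mem_spine_iff hm, not_le]
    exact s.lt_last
  injective_type₁' h := ConsecutiveSimplex.eq_of_mk_eq h
  injective_type₂' {s t} h := by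
    obtain ⟨d, x, hx, hx'⟩ := s
    obtain ⟨e, y, hy, hy'⟩ := t
    have hd : d + 1 = e + 1 := SSet.S.dim_eq_of_mk_eq h
    obtain rfl : d = e := by omega
    rw [SSet.S.ext_iff] at h
    obtain rfl := ConsecutiveSimplex.eq_of_δ_eq hx' hy' h
    rfl
  type₁_ne_type₂' s t h := by
    obtain ⟨d, x, hx, hx'⟩ := s
    obtain ⟨e, y, hy, hy'⟩ := t
    have hd : d + 2 = e + 1 := SSet.S.dim_eq_of_mk_eq h
    obtain rfl : e = d + 1 := by omega
    rw [SSet.S.ext_iff] at h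
    dsimp only at h hx'
    have h0 : x 0 = y 0 := DFunLike.congr_fun h 0
    have h1 : x 1 = y 2 := DFunLike.congr_fun h 1
    have h2 : (y 1 : ℕ) < y 2 := hy (fin_one_lt_two (d + 1))
    rw [h0, h1] at hx'
    omega
  surjective' a := by
    obtain ⟨e, x, hx, hx', rfl⟩ := a.mk_surjective
    rw [SSet.stdSimplex.mem_nonDegenerate_iff_strictMono] at hx
    rw [mem_spine_iff hm, not_le] at hx'
    change ∃ s : ConsecutiveSimplex.{u} m, SSet.S.mk x = _ ∨ SSet.S.mk x = _
    obtain _ | d := e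
    · exact absurd hx' (by change ¬ ((x 0 : ℕ) + 1 < x 0); omega)
    · by_cases h1 : (x 1 : ℕ) = x 0 + 1
      · obtain _ | d := d
        · change (x 0 : ℕ) + 1 < x 1 at hx'
          omega
        · exact ⟨⟨d, x, hx, h1⟩, Or.inl rfl⟩
      · have h01 : (x 0 : ℕ) < x 1 := hx (show (0 : Fin (d + 2)) < 1 by simp)
        obtain ⟨s, rfl, hs⟩ := ConsecutiveSimplex.exists_of_strictMono x hx (by omega)
        exact ⟨s, Or.inr (by rw [SSet.S.ext_iff]; exact hs.symm)⟩

/-- The rank is `m` minus the first vertex. If the face of `x` omitting its second vertex is also a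
face of another paired simplex `y`, it must omit the first vertex of `y`, so the first vertex of `x`
is strictly larger. -/
lemma isRegular_spinePairing {m : ℕ} (hm : 1 ≤ m) : (spinePairing.{u} hm).IsRegular := by
  refine SSet.Subcomplex.PairingCore.WeakRankFunction.isRegular (α := ℕ)
    { rank := fun s => m - (s.x 0 : Fin (m + 1))
      lt := ?_ }
  rintro ⟨d, x, hx, hx'⟩ ⟨e, y, hy, hy'⟩ ⟨hne, hlt⟩ hdim
  have hde : d + 1 = e + 1 := hdim
  obtain rfl : d = e := by omega
  obtain ⟨f, hf, hfx⟩ := SSet.N.le_iff_exists_mono.1 hlt.le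
  change ⦋d + 1⦌ ⟶ ⦋d + 2⦌ at f
  have : Mono f := hf
  dsimp only at *
  have hfx' : ∀ j : Fin (d + 2), y (f.toOrderHom j) = x ((1 : Fin (d + 3)).succAbove j) :=
    fun j => DFunLike.congr_fun (show (Δ[m] : SSet.{u}).map f.op y = (Δ[m] : SSet.{u}).δ 1 x
      from hfx) j
  have h0 : y (f.toOrderHom 0) = x 0 := hfx' 0
  have hle : y 0 ≤ x 0 := by
    rw [← h0]
    exact hy.monotone (Fin.zero_le _)
  rcases hle.lt_or_eq with hlt' | heq
  · have := (x 0).isLt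
    have : (y 0 : ℕ) < x 0 := hlt'
    omega
  · exfalso
    have hf0 : f.toOrderHom 0 = (0 : Fin (d + 3)) := hy.injective (h0.trans heq.symm)
    obtain ⟨i, rfl⟩ := SimplexCategory.eq_δ_of_mono f
    change i.succAbove 0 = 0 at hf0
    have hi0 : i ≠ 0 := by
      rintro rfl
      simp at hf0
    have hi1 : i = 1 := by
      -- For `i ≥ 2` the face of `y` keeps two consecutive first vertices, whereas the face of `x`
      -- has a gap there.
      by_contra hi1
      have h1 : i.succAbove 1 = 1 := by
        rw [Fin.succAbove_of_castSucc_lt]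
        · rfl
        · have h0' : (i : ℕ) ≠ 0 := fun h => hi0 (Fin.ext h)
          have h1' : (i : ℕ) ≠ 1 := fun h => hi1 (Fin.ext h)
          rw [Fin.lt_def]
          simp
          omega
      have h2 : y (i.succAbove 1) = x 2 := hfx' 1
      have h3 : (x 1 : ℕ) < x 2 := hx (fin_one_lt_two d)
      rw [h1] at h2
      rw [← h2, hy', hx', heq] at h3
      omega
    subst hi1
    obtain rfl := ConsecutiveSimplex.eq_of_δ_eq hy' hx' hfx
    exact hne rfl

lemma anodyneExtensions_spine_ι {m : ℕ} (hm : 1 ≤ m) :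
    SSet.anodyneExtensions (spine.{u} m).ι := by
  have := isRegular_spinePairing.{u} hm
  exact (spinePairing.{u} hm).pairing.anodyneExtensions

/-! ### The attaching map is anodyne on diagonals -/

lemma isPushout_diagonal_map {A B C D : BiSSet.{u}} {f : A ⟶ B} {g : A ⟶ C} {h : B ⟶ D}
    {i : C ⟶ D} (sq : IsPushout f g h i) :
    IsPushout (diagonal.map f) (diagonal.map g) (diagonal.map h) (diagonal.map i) :=
  IsPushout.of_forall_isPushout_app fun k => (sq.app k).app k

/-- The diagonal of an exterior product is a product. -/
def diagonalExtProdIso (X B : SSet.{u}) : diagonal.obj (extProd X B) ≅ X ⊗ B :=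
  NatIso.ofComponents (fun _ => Iso.refl _) (fun _ => rfl)

lemma ι₀_app_ne_ι₁_app {X : SSet.{u}} {k : SimplexCategoryᵒᵖ} (x y : X.obj k) :
    (SSet.ι₀ (X := X)).app k x ≠ (SSet.ι₁ (X := X)).app k y := by
  induction k using Opposite.rec with | _ k
  induction k using SimplexCategory.rec with | _ n
  intro h
  have h' := congrArg (fun z => (z.2 : (Δ[1] : SSet.{u}) _⦋n⦌) 0) h
  have h01 : (0 : Fin 2) = 1 := h'
  exact absurd h01 (by decide)

open Classical in
-- In each degree, sending the glued end to `none` and any other simplex of the cylinder to its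
-- first component recovers the argument of `a`. This function need not be simplicial, since
-- injectivity is tested degreewise.
lemma mono_cylIncl (A : BiSSet.{u}) (m : ℕ) : Mono (cylIncl A m) := by
  have (k : SimplexCategoryᵒᵖ) : Mono ((cylIncl A m).app k) := by
    have sq : IsPushout ((SSet.ι₁ (X := A.obj (op ⦋m⦌))).app k) ((segalMap A m).app k)
        ((cylInl A m).app k) ((pushout.inr (SSet.ι₁ (X := A.obj (op ⦋m⦌))) (segalMap A m)).app k) :=
      (IsPushout.of_hasPushout (SSet.ι₁ (X := A.obj (op ⦋m⦌))) (segalMap A m)).app k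
    let f : (A.obj (op ⦋m⦌) ⊗ Δ[1] : SSet.{u}).obj k ⟶ Option ((A.obj (op ⦋m⦌)).obj k) :=
      TypeCat.ofHom fun z =>
        if z ∈ Set.range ((SSet.ι₁ (X := A.obj (op ⦋m⦌))).app k) then none else some z.1
    let g : (segalProduct A m).obj k ⟶ Option ((A.obj (op ⦋m⦌)).obj k) :=
      TypeCat.ofHom fun _ => none
    have w : (SSet.ι₁ (X := A.obj (op ⦋m⦌))).app k ≫ f = (segalMap A m).app k ≫ g := by
      exact ConcreteCategory.hom_ext _ _ fun x => if_pos ⟨x, rfl⟩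
    have hf : ∀ x, sq.desc f g w ((cylIncl A m).app k x) = some x := fun x => by
      refine (ConcreteCategory.congr_hom (sq.inl_desc f g w)
        ((SSet.ι₀ (X := A.obj (op ⦋m⦌))).app k x)).trans ?_
      refine if_neg ?_
      rintro ⟨y, hy⟩
      exact ι₀_app_ne_ι₁_app x y hy.symm
    rw [mono_iff_injective]
    intro x y hxy
    have h := congrArg (sq.desc f g w) hxy
    rw [hf, hf] at h
    exact Option.some.inj h
  exact NatTrans.mono_of_mono_app _

lemma inl_attachUV (m : ℕ) {B' B : SSet.{u}} (j : B' ⟶ B) :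
    pushout.inl (extProdMap (𝟙 (spine.{u} m).toSSet) j) (extProdMap (spine.{u} m).ι (𝟙 B')) ≫
      attachUV m j = extProdMap (spine.{u} m).ι (𝟙 B) :=
  pushout.inl_desc _ _ _

lemma inr_attachUV (m : ℕ) {B' B : SSet.{u}} (j : B' ⟶ B) :
    pushout.inr (extProdMap (𝟙 (spine.{u} m).toSSet) j) (extProdMap (spine.{u} m).ι (𝟙 B')) ≫
      attachUV m j = extProdMap (𝟙 Δ[m]) j :=
  pushout.inr_desc _ _ _

lemma anodyneExtensions_of_comp_iso {X Y Z : SSet.{u}} (f : X ⟶ Y) (e : Y ≅ Z)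
    (h : SSet.anodyneExtensions (f ≫ e.hom)) : SSet.anodyneExtensions f :=
  (MorphismProperty.cancel_right_of_respectsIso _ f e.hom).1 h

lemma anodyneExtensions_diagonal_attachUV {m : ℕ} (hm : 1 ≤ m) {B' B : SSet.{u}} (j : B' ⟶ B)
    [Mono j] : SSet.anodyneExtensions (diagonal.map (attachUV m j)) := by
  have sq := isPushout_diagonal_map (IsPushout.of_hasPushout
    (extProdMap (𝟙 (spine.{u} m).toSSet) j) (extProdMap (spine.{u} m).ι (𝟙 B')))
  -- The two legs are in the opposite order to those of `attachU`, hence the `flip` below.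
  let P : (curriedTensor SSet.{u}).PushoutObjObj (spine.{u} m).ι j :=
    { pt := diagonal.obj (attachU m j)
      inl := (diagonalExtProdIso _ _).inv ≫ diagonal.map (pushout.inr _ _)
      inr := (diagonalExtProdIso _ _).inv ≫ diagonal.map (pushout.inl _ _)
      isPushout := by
        refine sq.flip.of_iso (diagonalExtProdIso _ _) (diagonalExtProdIso _ _)
          (diagonalExtProdIso _ _) (Iso.refl _) ?_ ?_ ?_ ?_
        · rfl
        · rfl
        · rw [Iso.hom_inv_id_assoc]
          exact Category.comp_id _
        · rw [Iso.hom_inv_id_assoc]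
          exact Category.comp_id _
      ι := diagonal.map (attachUV m j) ≫ (diagonalExtProdIso _ _).hom
      inl_ι := by
        have h := (diagonal.map_comp _ _).symm.trans (congrArg diagonal.map
          (inr_attachUV m j))
        refine (Category.assoc _ _ _).trans ?_
        refine congrArg (fun t => _ ≫ t) ((Category.assoc _ _ _).symm.trans
          (congrArg (fun t => t ≫ (diagonalExtProdIso Δ[m] B).hom) h))
      inr_ι := by
        have h := (diagonal.map_comp _ _).symm.trans (congrArg diagonal.map
          (inl_attachUV m j))
        refine (Category.assoc _ _ _).trans ?_
        refine congrArg (fun t => _ ≫ t) ((Category.assoc _ _ _).symm.trans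
          (congrArg (fun t => t ≫ (diagonalExtProdIso Δ[m] B).hom) h)) }
  have h := SSet.anodyneExtensions_pushoutObjObjι' P (anodyneExtensions_spine_ι hm)
  exact anodyneExtensions_of_comp_iso _ (diagonalExtProdIso Δ[m] B) h

/-! ### `Arr` is a pushout -/

lemma factorsThroughEdge_zero {m : ℕ} (hm : 1 ≤ m) (g : ⦋0⦌ ⟶ ⦋m⦌) : FactorsThroughEdge g := by
  have h := (mem_spine_iff.{0} hm (SSet.stdSimplex.objEquiv.symm g)).2 (Nat.le_succ _)
  exact factorsThroughEdge_of_mem_spine h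

/-- No copy of `C` is glued in degree `0`, so constancy is transported along the isomorphism `A_{0/}
⟶ Arr(A,m)_{0/}`. -/
lemma isSegalPrecat_arr {A : BiSSet.{u}} (hA : IsSegalPrecat A) {m : ℕ} (hm : 1 ≤ m) :
    IsSegalPrecat (arr A m) := by
  intro k l φ
  have : IsEmpty (NonEdge ⦋0⦌ m) := ⟨fun g => g.2 (factorsThroughEdge_zero hm g.1)⟩
  have : IsIso (arrInclApp A m ⦋0⦌) := by
    have : IsIso (Limits.Sigma.map (fun _ : NonEdge ⦋0⦌ m => cylIncl A m)) := by
      refine ⟨Limits.Sigma.desc fun g => isEmptyElim g, ?_, ?_⟩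
      · exact Limits.Sigma.hom_ext _ _ fun g => isEmptyElim g
      · exact Limits.Sigma.hom_ext _ _ fun g => isEmptyElim g
    exact inferInstanceAs (IsIso (pushout.inl
      (Limits.Sigma.desc (fun g : NonEdge ⦋0⦌ m => A.map g.1.op) :
        (∐ fun _ : NonEdge ⦋0⦌ m => A.obj (op ⦋m⦌)) ⟶ A.obj (op ⦋0⦌))
      (Limits.Sigma.map (fun _ : NonEdge ⦋0⦌ m => cylIncl A m))))
  have := hA φ
  have h := (arrInclApp A m ⦋0⦌).naturality φ
  have h' : (arrObj A m ⦋0⦌).map φ = inv ((arrInclApp A m ⦋0⦌).app k) ≫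
      (A.obj (op ⦋0⦌)).map φ ≫ (arrInclApp A m ⦋0⦌).app l := by
    rw [h, IsIso.inv_hom_id_assoc]
  change IsIso ((arrObj A m ⦋0⦌).map φ)
  rw [h']
  infer_instance

lemma mono_arrIncl (A : BiSSet.{u}) (m : ℕ) : Mono (arrIncl A m) := by
  have (p : SimplexCategoryᵒᵖ) : Mono ((arrIncl A m).app p) := by
    have := mono_cylIncl A m
    have h : MorphismProperty.monomorphisms SSet.{u}
        (Limits.Sigma.map (fun _ : NonEdge p.unop m => cylIncl A m)) :=
      inferInstanceAs (Mono (Limits.Sigma.map _))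
    exact MorphismProperty.pushout_inl (P := MorphismProperty.monomorphisms SSet.{u}) _ _ h
  exact NatTrans.mono_of_mono_app _

lemma inl_arrAttach (A : BiSSet.{u}) (m : ℕ) :
    pushout.inl (extProdMap (𝟙 (spine.{u} m).toSSet) (cylIncl A m))
      (extProdMap (spine.{u} m).ι (𝟙 _)) ≫ arrAttach A m = spineHom (cylProj A m) :=
  pushout.inl_desc _ _ _

lemma inr_arrAttach (A : BiSSet.{u}) (m : ℕ) :
    pushout.inr (extProdMap (𝟙 (spine.{u} m).toSSet) (cylIncl A m))
      (extProdMap (spine.{u} m).ι (𝟙 _)) ≫ arrAttach A m = simplexHom (𝟙 _) :=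
  pushout.inr_desc _ _ _

/-- The simplex of an exterior product given by a pair of simplices. -/
def extProdMk {X B : SSet.{u}} {p k : SimplexCategoryᵒᵖ} (x : X.obj p) (c : B.obj k) :
    ((extProd X B).obj p).obj k :=
  (x, c)

/-! ### Maps out of `Arr(A,m)` from compatible maps out of `V` and `A`. -/

section Desc

variable {A : BiSSet.{u}} {m : ℕ} {Z : BiSSet.{u}} (f : extProd Δ[m] (cyl A m) ⟶ Z) (g : A ⟶ Z)

/-- The component of a map from an exterior product with the standard simplex. -/
def attachComponent {B : SSet.{u}} (f : extProd Δ[m] B ⟶ Z) {p : SimplexCategory} (e : p ⟶ ⦋m⦌) :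
    B ⟶ Z.obj (op p) where
  app k := TypeCat.ofHom fun c =>
    (f.app (op p)).app k (extProdMk (SSet.stdSimplex.objEquiv.symm e) c)
  naturality k l φ := by
    ext c
    exact ConcreteCategory.congr_hom ((f.app (op p)).naturality φ)
      (extProdMk (B := B) (p := op p) (k := k) (SSet.stdSimplex.objEquiv.symm e) c)

lemma attachComponent_map {B : SSet.{u}} (f : extProd Δ[m] B ⟶ Z) {p q : SimplexCategory}
    (e : p ⟶ ⦋m⦌) (θ : q ⟶ p) :
    attachComponent f e ≫ Z.map θ.op = attachComponent f (θ ≫ e) := by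
  ext k c
  have h := congrArg (fun t => t.app k (extProdMk (SSet.stdSimplex.objEquiv.symm e) c))
    (f.naturality θ.op)
  exact h.symm

lemma attachV_hom_ext {B : SSet.{u}} {f g : extProd Δ[m] B ⟶ Z}
    (h : ∀ (p : SimplexCategory) (e : p ⟶ ⦋m⦌), attachComponent f e = attachComponent g e) :
    f = g := by
  ext p k ⟨x, c⟩
  have := congrArg (fun t => t.app k c) (h p.unop (SSet.stdSimplex.objEquiv x))
  exact this

lemma attachComponent_arrCell {p : SimplexCategory} (e : p ⟶ ⦋m⦌) :
    attachComponent (arrCell A m) e = arrCyl A m e := by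
  have h := arrCyl_arrMap A m e (𝟙 _)
  rw [Category.comp_id] at h
  exact h

variable (w : attachUV m (cylIncl A m) ≫ f = arrAttach A m ≫ g)

include w in
-- This is the compatibility `w` read on the part `h(m) ⊗ A_{m/}` of `U`.
lemma cylIncl_attachComponent {p : SimplexCategory} (e : p ⟶ ⦋m⦌) :
    cylIncl A m ≫ attachComponent f e = A.map e.op ≫ g.app (op p) := by
  have h : extProdMap (𝟙 Δ[m]) (cylIncl A m) ≫ f = simplexHom (𝟙 _) ≫ g :=
    (congrArg (fun t => t ≫ f) (inr_attachUV m (cylIncl A m))).symm.trans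
      ((Category.assoc _ _ _).trans ((congrArg (fun t => pushout.inr _ _ ≫ t) w).trans
        ((Category.assoc _ _ _).symm.trans (congrArg (fun t => t ≫ g) (inr_arrAttach A m)))))
  ext k c
  exact congrArg (fun t => (t.app (op p)).app k (extProdMk (SSet.stdSimplex.objEquiv.symm e) c)) h

lemma mem_spine_of_factors {p : SimplexCategory} (e : p ⟶ ⦋m⦌) (he : FactorsThroughEdge e) :
    SSet.stdSimplex.objEquiv.symm e ∈ (spine.{u} m).obj (op p) := by
  obtain ⟨i, d, rfl⟩ := he
  simp only [spine, Subfunctor.iSup_obj, Set.mem_iUnion]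
  exact ⟨i, SSet.stdSimplex.objEquiv.symm d, rfl⟩

include w in
-- This is `w` read on `Σ(m) ⊗ C`: these components are dictated by the map from `A`, which is why
-- `Arr` needs no copy of `C` for them.
lemma attachComponent_of_factors {p : SimplexCategory} (e : p ⟶ ⦋m⦌) (he : FactorsThroughEdge e) :
    attachComponent f e = cylProj A m ≫ edgeMap A e he ≫ g.app (op p) := by
  have h : extProdMap (spine.{u} m).ι (𝟙 (cyl A m)) ≫ f = spineHom (cylProj A m) ≫ g :=
    (congrArg (fun t => t ≫ f) (inl_attachUV m (cylIncl A m))).symm.trans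
      ((Category.assoc _ _ _).trans ((congrArg (fun t => pushout.inl _ _ ≫ t) w).trans
        ((Category.assoc _ _ _).symm.trans (congrArg (fun t => t ≫ g) (inl_arrAttach A m)))))
  ext k c
  exact congrArg (fun t => (t.app (op p)).app k
    (⟨SSet.stdSimplex.objEquiv.symm e, mem_spine_of_factors e he⟩, c)) h

/-- The map from `Arr(A,m)_{p/}` induced by compatible maps from the copies of `C` and `A`. -/
def arrDescApp (p : SimplexCategory) : arrObj A m p ⟶ Z.obj (op p) :=
  pushout.desc (g.app (op p)) (Limits.Sigma.desc fun e => attachComponent f e.1) (by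
    apply Limits.Sigma.hom_ext
    intro e
    simp only [Limits.Sigma.ι_desc_assoc, Limits.Sigma.ι_map_assoc, Limits.Sigma.ι_desc]
    exact (cylIncl_attachComponent f g w e.1).symm)

lemma arrInclApp_arrDescApp (p : SimplexCategory) :
    arrInclApp A m p ≫ arrDescApp f g w p = g.app (op p) :=
  pushout.inl_desc _ _ _

lemma arrCyl_arrDescApp {p : SimplexCategory} (e : p ⟶ ⦋m⦌) :
    arrCyl A m e ≫ arrDescApp f g w p = attachComponent f e := by
  by_cases he : FactorsThroughEdge e
  · rw [arrCyl_of_factors A m e he, attachComponent_of_factors f g w e he, Category.assoc,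
      Category.assoc, arrInclApp_arrDescApp]
  · rw [arrCyl_of_not_factors A m e he]
    refine (Category.assoc _ _ _).trans ?_
    refine (congrArg (fun t => _ ≫ t) (pushout.inr_desc _ _ _)).trans ?_
    exact Limits.Sigma.ι_desc _ _

/-- The map from `Arr(A,m)` induced by compatible maps from `V` and `A`. -/
def arrDesc : arr A m ⟶ Z where
  app p := arrDescApp f g w p.unop
  naturality p q θ := by
    refine arr_hom_ext ?_ fun e _ => ?_
    · change arrInclApp A m p.unop ≫ arrMap A m θ.unop ≫ _ = arrInclApp A m p.unop ≫ _ ≫ _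
      rw [← Category.assoc, arrInclApp_arrMap, Category.assoc, arrInclApp_arrDescApp,
        ← Category.assoc, arrInclApp_arrDescApp]
      exact g.naturality θ
    · change arrCyl A m e ≫ arrMap A m θ.unop ≫ _ = arrCyl A m e ≫ _ ≫ _
      rw [← Category.assoc, arrCyl_arrMap, arrCyl_arrDescApp, ← Category.assoc, arrCyl_arrDescApp]
      exact (attachComponent_map f e θ.unop).symm

end Desc

lemma isPushout_arr (A : BiSSet.{u}) (m : ℕ) :
    IsPushout (attachUV m (cylIncl A m)) (arrAttach A m) (arrCell A m) (arrIncl A m) where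
  w := by
    apply pushout.hom_ext
    · refine (Category.assoc _ _ _).symm.trans ((congrArg (fun t => t ≫ arrCell A m)
        (inl_attachUV m (cylIncl A m))).trans (Eq.trans ?_ ((congrArg (fun t => t ≫ arrIncl A m)
          (inl_arrAttach A m)).symm.trans (Category.assoc _ _ _))))
      ext p k ⟨x, c⟩
      have h := arrCyl_of_factors A m _ (factorsThroughEdge_of_mem_spine x.2)
      rw [← attachComponent_arrCell] at h
      exact congrArg (fun t => t.app k c) h
    · refine (Category.assoc _ _ _).symm.trans ((congrArg (fun t => t ≫ arrCell A m)
        (inr_attachUV m (cylIncl A m))).trans (Eq.trans ?_ ((congrArg (fun t => t ≫ arrIncl A m)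
          (inr_arrAttach A m)).symm.trans (Category.assoc _ _ _))))
      ext p k ⟨x, c⟩
      have h := cylIncl_arrCyl A m (SSet.stdSimplex.objEquiv x)
      rw [← attachComponent_arrCell] at h
      exact congrArg (fun t => t.app k c) h
  isColimit' := ⟨PushoutCocone.IsColimit.mk _ (fun s => arrDesc s.inl s.inr s.condition)
    (fun s => attachV_hom_ext fun p e => by
      refine (congrArg (fun t => t ≫ arrDescApp s.inl s.inr s.condition p)
        (attachComponent_arrCell e)).trans ?_
      exact arrCyl_arrDescApp _ _ s.condition e)
    (fun s => by
      refine NatTrans.ext (funext fun p => ?_)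
      exact arrInclApp_arrDescApp _ _ s.condition p.unop)
    (fun s l h₁ h₂ => by
      refine NatTrans.ext (funext fun p => ?_)
      refine arr_hom_ext ?_ fun e _ => ?_
      · refine Eq.trans ?_ (arrInclApp_arrDescApp _ _ s.condition p.unop).symm
        exact congrArg (fun t => t.app p) h₂
      · refine Eq.trans ?_ (arrCyl_arrDescApp _ _ s.condition e).symm
        rw [← attachComponent_arrCell, ← h₁]
        rfl)⟩

end SegalPrecat

end

/-! ### Assembly of the lemma. -/

theorem mainTheorem6 (A : SegalPrecat.BiSSet.{u}) (hA : SegalPrecat.IsSegalPrecat A)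
    (m : ℕ) (hm : 1 ≤ m) :
    SegalPrecat.IsSegalPrecat (SegalPrecat.arr A m) ∧
    Mono (SegalPrecat.arrIncl A m) ∧
    IsPushout (SegalPrecat.attachUV m (SegalPrecat.cylIncl A m)) (SegalPrecat.arrAttach A m)
      (SegalPrecat.arrCell A m) (SegalPrecat.arrIncl A m) ∧
    SegalPrecat.IsWeakEquivalence
      (SegalPrecat.realization.map (SegalPrecat.attachUV m (SegalPrecat.cylIncl A m))).hom ∧
    Topology.IsEmbedding (SegalPrecat.realization.map (SegalPrecat.arrIncl A m)).hom ∧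
    SegalPrecat.IsWeakEquivalence
      (SegalPrecat.realization.map (SegalPrecat.arrIncl A m)).hom := by
  have := SegalPrecat.mono_cylIncl A m
  have hUV := SegalPrecat.anodyneExtensions_diagonal_attachUV hm (SegalPrecat.cylIncl A m)
  have hArr : SSet.anodyneExtensions (SegalPrecat.diagonal.map (SegalPrecat.arrIncl A m)) :=
    MorphismProperty.of_isPushout
      (SegalPrecat.isPushout_diagonal_map (SegalPrecat.isPushout_arr A m)).flip hUV
  have h₁ := (SegalPrecat.hurewiczAcyclic_of_anodyneExtensions hUV).isStrongDeformationRetract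
  have h₂ := (SegalPrecat.hurewiczAcyclic_of_anodyneExtensions hArr).isStrongDeformationRetract
  exact ⟨SegalPrecat.isSegalPrecat_arr hA hm, SegalPrecat.mono_arrIncl A m,
    SegalPrecat.isPushout_arr A m, h₁.isWeakEquivalence, h₂.isEmbedding, h₂.isWeakEquivalence⟩
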